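/- All rings are associative with identity, and modules are unitary left modules. For a ring $R$ and an $R$-module $C$, let $\mathrm{Add}_R(C)$ be the class of modules isomorphic to direct summands of direct sums of copies of $C$. For a class $\mathcal F$ of modules, an exact sequence is called $\mathrm{Hom}_R(-,\mathcal F)$-exact if $\mathrm{Hom}_R(-,F)$ leaves it exact for every $F\in\mathcal F$. - $C$ is weakly Wakamatsu tilting (w-tilting) if $\mathrm{Ext}_R^{i}(C,C^{(I)})=0$ for all $i\ge 1$ and all sets $I$, and there is a $\mathrm{Hom}_R(-,\mathrm{Add}_R(C))$-exact exact sequence $0\to R\to A^0\to A^1\to\cdots$ with all $A^i\in\mathrm{Add}_R(C)$. - $M$ is $G_C$-projective if there is a $\mathrm{Hom}_R(-,\mathrm{Add}_R(C))$-exact exact sequence $\cdots\to P_1\to P_0\to A^0\to A^1\to\cdots$ with all $P_i$ projective, all $A^i\in\mathrm{Add}_R(C)$ and $M\cong\mathrm{Im}(P_0\to A^0)$. $M$ is Gorenstein projective if the same holds with the class of projective modules in place of $\mathrm{Add}_R(C)$. - The $G_C$-projective dimension (resp. Gorenstein projective dimension) of $M$ is the least $n\ge 0$ for which there is an exact sequence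 $0\to G_n\to\cdots\to G_0\to M\to 0$ with all $G_i$ $G_C$-projective (resp. Gorenstein projective), and $\infty$ if there is none. $G_C\text{-}PD(R)$ (resp. $l.\mathrm{Ggldim}(R)$) is the supremum of these dimensions over all $R$-modules $M$. For an integer $n\geq 0$, $R$ is left $n$-Gorenstein regular if $l.\mathrm{Ggldim}(R)=n$. Let $R$ be a nonzero ring and $T(R)=\begin{pmatrix}R&0\\R&R\end{pmatrix}$. A left $T(R)$-module is identified with a triple $\begin{pmatrix}M_1\\M_2\end{pmatrix}_{\varphi}$, where $M_1,M_2$ are $R$-modules and $\varphi:M_1\to M_2$ is $R$-linear; its elements are columns on which $T(R)$ acts by $\begin{pmatrix}a&0\\u&b\end{pmatrix}\begin{pmatrix}x\\y\end{pmatrix}=\begin{pmatrix}ax\\ \varphi(ux)+by\end{pmatrix}$. For $R$-modules $M_1,M_2$ let $\mathbf p(M_1,M_2)=\begin{pmatrix}M_1\\M_1\oplus M_2\end{pmatrix}$ with structure map the inclusion $M_1\to M_1\oplus M_2$. Corollary. 1. For every w-tilting $R$-module $C_1$, with $C=\mathbf p(C_1,C_1)$, $$G_C\text{-}PD(T(R))=G_{C_1}\text{-}PD(R)+1$$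 (where $\infty+1=\infty$). 2. For every integer $n\ge 0$, $T(R)$ is left $(n+1)$-Gorenstein regular if and only if $R$ is left $n$-Gorenstein regular. -/

import Mathlib

universe u

/-! ### Relative Gorenstein projective modules -/

section RelativeGorenstein

variable (R : Type u) [Ring R]

/-- `Add_R(C)`: the class of all modules isomorphic to a direct summand of a direct sum of copies
of `C`. -/
def InAdd (C : Type u) [AddCommGroup C] [Module R C] (M : ModuleCat.{u} R) : Prop :=
  ∃ (I : Type u) (N : ModuleCat.{u} R), Nonempty ((M × N) ≃ₗ[R] (I →₀ C))

variable {R}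

/-- The sequence `X → Y → Z` is exact at `Y`, and for every `F` in the class `𝓕` the sequence
`Hom(Z, F) → Hom(Y, F) → Hom(X, F)` is exact at `Hom(Y, F)`. -/
def IsHomExactAt (𝓕 : ModuleCat.{u} R → Prop) {X Y Z : Type u}
    [AddCommGroup X] [Module R X] [AddCommGroup Y] [Module R Y] [AddCommGroup Z] [Module R Z]
    (f : X →ₗ[R] Y) (g : Y →ₗ[R] Z) : Prop :=
  Function.Exact f g ∧
    ∀ F : ModuleCat.{u} R, 𝓕 F →
      Function.Exact (fun h : Z →ₗ[R] F => h ∘ₗ g) (fun h : Y →ₗ[R] F => h ∘ₗ f)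

/-- There is a `Hom(-, 𝓕)`-exact exact sequence `⋯ → P₁ → P₀ → A⁰ → A¹ → ⋯` in which all `Pᵢ` are
projective, all `Aⁱ` are in `𝓕`, and `M ≅ Im(P₀ → A⁰)`. -/
def HasCompleteResolution (𝓕 : ModuleCat.{u} R → Prop) (M : ModuleCat.{u} R) : Prop :=
  ∃ (P A : ℕ → ModuleCat.{u} R)
    (p : ∀ n, P (n + 1) →ₗ[R] P n) (d : P 0 →ₗ[R] A 0) (a : ∀ n, A n →ₗ[R] A (n + 1)),
    (∀ n, Module.Projective R (P n)) ∧
    (∀ n, 𝓕 (A n)) ∧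
    (∀ n, IsHomExactAt 𝓕 (p (n + 1)) (p n)) ∧
    IsHomExactAt 𝓕 (p 0) d ∧
    IsHomExactAt 𝓕 d (a 0) ∧
    (∀ n, IsHomExactAt 𝓕 (a n) (a (n + 1))) ∧
    Nonempty (M ≃ₗ[R] LinearMap.range d)

variable (R)

/-- `G_C`-projective modules. -/
def IsGCProjective (C : Type u) [AddCommGroup C] [Module R C] (M : ModuleCat.{u} R) : Prop :=
  HasCompleteResolution (InAdd R C) M

/-- Gorenstein projective modules. -/
def IsGorensteinProjective (M : ModuleCat.{u} R) : Prop :=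
  HasCompleteResolution (fun N : ModuleCat.{u} R => Module.Projective R N) M

/-- `C` is weakly Wakamatsu tilting: `Ext^i(C, C^(I)) = 0` for all `i ≥ 1` and all sets `I`, and
there is a `Hom(-, Add(C))`-exact exact sequence `0 → R → A⁰ → A¹ → ⋯` with all `Aⁱ` in
`Add(C)`. -/
def IsWTilting (C : Type u) [AddCommGroup C] [Module R C] : Prop :=
  (∀ (I : Type u) (i : ℕ), 1 ≤ i →
    Subsingleton (CategoryTheory.Abelian.Ext (ModuleCat.of R C) (ModuleCat.of R (I →₀ C)) i)) ∧
  ∃ (A : ℕ → ModuleCat.{u} R) (e : R →ₗ[R] A 0) (a : ∀ n, A n →ₗ[R] A (n + 1)),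
    (∀ n, InAdd R C (A n)) ∧
    IsHomExactAt (InAdd R C) (0 : PUnit.{u + 1} →ₗ[R] R) e ∧
    IsHomExactAt (InAdd R C) e (a 0) ∧
    (∀ n, IsHomExactAt (InAdd R C) (a n) (a (n + 1)))

variable {R}

/-- There is an exact sequence `0 → Gₙ → ⋯ → G₀ → M → 0` with all `Gᵢ` in `𝓖`. -/
def HasResolutionOfLength (𝓖 : ModuleCat.{u} R → Prop) (M : ModuleCat.{u} R) (n : ℕ) : Prop :=
  ∃ (G : ℕ → ModuleCat.{u} R) (g : ∀ i, G (i + 1) →ₗ[R] G i) (e : G 0 →ₗ[R] M),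
    (∀ i, i ≤ n → 𝓖 (G i)) ∧
    (∀ i, n < i → Subsingleton (G i)) ∧
    Function.Surjective e ∧
    Function.Exact (g 0) e ∧
    ∀ i, Function.Exact (g (i + 1)) (g i)

/-- The least length of a resolution of `M` by modules in `𝓖`, and `⊤` if there is none. -/
noncomputable def resolutionDim (𝓖 : ModuleCat.{u} R → Prop) (M : ModuleCat.{u} R) : ℕ∞ :=
  ⨅ (n : ℕ) (_ : HasResolutionOfLength 𝓖 M n), (n : ℕ∞)

variable (R)

/-- The `G_C`-projective dimension of a module. -/
noncomputable def gcProjectiveDim (C : Type u) [AddCommGroup C] [Module R C]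
    (M : ModuleCat.{u} R) : ℕ∞ :=
  resolutionDim (IsGCProjective R C) M

/-- The left `G_C`-projective global dimension of `R`. -/
noncomputable def gcProjectiveGlobalDim (C : Type u) [AddCommGroup C] [Module R C] : ℕ∞ :=
  ⨆ M : ModuleCat.{u} R, gcProjectiveDim R C M

/-- The Gorenstein projective dimension of a module. -/
noncomputable def gorensteinProjectiveDim (M : ModuleCat.{u} R) : ℕ∞ :=
  resolutionDim (IsGorensteinProjective R) M

/-- The left global Gorenstein dimension of `R`. -/
noncomputable def leftGorensteinGlobalDim : ℕ∞ :=
  ⨆ M : ModuleCat.{u} R, gorensteinProjectiveDim R M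

/-- `R` is left `n`-Gorenstein regular: its left global Gorenstein dimension is finite and equal
to `n`. -/
def IsLeftGorensteinRegular (n : ℕ) : Prop :=
  leftGorensteinGlobalDim R = (n : ℕ∞)

end RelativeGorenstein

/-! ### The ring `T(R)` and its modules -/

section Triangular

variable (R : Type u) [Ring R]

/-- The ring `T(R)` of lower triangular `2 × 2` matrices over `R`. -/
def T2 : Subring (Matrix (Fin 2) (Fin 2) R) where
  carrier := {m | m 0 1 = 0}
  mul_mem' := by
    intro a b (ha : a 0 1 = 0) (hb : b 0 1 = 0)
    change (a * b) 0 1 = 0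
    simp [Matrix.mul_apply, Fin.sum_univ_two, ha, hb]
  one_mem' := by simp
  add_mem' := by
    intro a b (ha : a 0 1 = 0) (hb : b 0 1 = 0)
    change a 0 1 + b 0 1 = 0
    simp [ha, hb]
  zero_mem' := by simp
  neg_mem' := by
    intro a (ha : a 0 1 = 0)
    change -a 0 1 = 0
    simp [ha]

variable {R}
variable {M₁ M₂ : Type u} [AddCommGroup M₁] [Module R M₁] [AddCommGroup M₂] [Module R M₂]

/-- The left `T(R)`-module given by the triple `(M₁, M₂)_φ` with `φ : M₁ → M₂`: its elements are
columns `(x, y)`, and `[[a, 0], [u, b]] • (x, y) = (a • x, φ (u • x) + b • y)`. -/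
def TriMod (_φ : M₁ →ₗ[R] M₂) : Type u := M₁ × M₂

instance (φ : M₁ →ₗ[R] M₂) : AddCommGroup (TriMod φ) :=
  inferInstanceAs (AddCommGroup (M₁ × M₂))

instance (φ : M₁ →ₗ[R] M₂) : SMul (T2 R) (TriMod φ) where
  smul t z := (t.1 0 0 • z.1, φ (t.1 1 0 • z.1) + t.1 1 1 • z.2)

theorem TriMod.smul_def (φ : M₁ →ₗ[R] M₂) (t : T2 R) (z : TriMod φ) :
    t • z = ((t.1 0 0 • z.1, φ (t.1 1 0 • z.1) + t.1 1 1 • z.2) : M₁ × M₂) := rfl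

instance (φ : M₁ →ₗ[R] M₂) : Module (T2 R) (TriMod φ) where
  one_smul z := by
    rw [TriMod.smul_def]
    refine Prod.ext ?_ ?_ <;> simp
  mul_smul s t z := by
    have hs : s.1 0 1 = 0 := s.2
    have ht : t.1 0 1 = 0 := t.2
    rw [TriMod.smul_def, TriMod.smul_def, TriMod.smul_def]
    refine Prod.ext ?_ ?_
    · simp [Matrix.mul_apply, Fin.sum_univ_two, hs, mul_smul]
    · simp [Matrix.mul_apply, Fin.sum_univ_two, ht, mul_smul, add_smul, add_assoc]
  smul_zero t := by
    rw [TriMod.smul_def]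
    refine Prod.ext ?_ ?_
    · exact smul_zero _
    · change φ (t.1 1 0 • (0 : M₁)) + t.1 1 1 • (0 : M₂) = 0
      simp
  smul_add t z w := by
    simp only [TriMod.smul_def]
    refine Prod.ext ?_ ?_
    · exact smul_add _ _ _
    · change φ (t.1 1 0 • (z.1 + w.1)) + t.1 1 1 • (z.2 + w.2) =
        (φ (t.1 1 0 • z.1) + t.1 1 1 • z.2) + (φ (t.1 1 0 • w.1) + t.1 1 1 • w.2)
      simp only [smul_add, map_add]
      abel
  add_smul s t z := by
    simp only [TriMod.smul_def]
    refine Prod.ext ?_ ?_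
    · exact add_smul _ _ _
    · change φ ((s.1 1 0 + t.1 1 0) • z.1) + (s.1 1 1 + t.1 1 1) • z.2 =
        (φ (s.1 1 0 • z.1) + s.1 1 1 • z.2) + (φ (t.1 1 0 • z.1) + t.1 1 1 • z.2)
      simp only [add_smul, map_add]
      abel
  zero_smul z := by
    rw [TriMod.smul_def]
    refine Prod.ext ?_ ?_
    · exact zero_smul _ _
    · change φ ((0 : R) • z.1) + (0 : R) • z.2 = 0
      simp

variable (R)

/-- The `T(R)`-module `p(M₁, M₂) = (M₁, (R ⊗ M₁) ⊕ M₂)`, where `R ⊗ M₁` is identified with `M₁`, so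
that the structure map is the inclusion `M₁ → M₁ ⊕ M₂`. -/
abbrev pMod (M₁ M₂ : Type u) [AddCommGroup M₁] [Module R M₁] [AddCommGroup M₂] [Module R M₂] :
    Type u :=
  TriMod (LinearMap.inl R M₁ M₂)

end Triangular

/-! Write a `T(R)`-module as `(M₁, M₂)_φ`. The heart of the argument is the criterion
`isGCProjective_pMod_iff`: for w-tilting `C₁` and `C = p(C₁, C₁)`, a module is `G_C`-projective
exactly when `φ` is injective and both `M₁` and `coker φ` are `G_{C₁}`-projective. It rests on the
fact that a map `M → p(X, Y)` is the same as a pair of maps `M₂ → X` and `coker φ → Y`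
(`pMod.exists_eq_lift`), so extending maps to `Add(p(C₁, C₁))` can be tested on second components
and on cokernels.

Projective `T(R)`-modules have injective structure map, and their components and cokernels are
projective. Comparing syzygies therefore turns the criterion into a statement on dimensions
(`hasResolutionOfLength_pMod_iff`): if `φ` is injective, `M` has dimension at most `n` iff `M₁` and
`coker φ` do. Every first syzygy has injective structure map, which gives the upper bound `n + 1`.
For the lower bound, a presentation `0 → K → P → N → 0` makes `(K → P)` a syzygy of `(N, 0)`; its
structure map is injective with cokernel `N`, so a bound `n + 1` for `(N, 0)` gives the bound `n`
for `N` (`hasResolutionOfLength_of_pMod`). Dimension zero is impossible over `T(R)`, because `(R,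
0)` has a noninjective structure map.

Dimension shifting needs the `G_C`-projectives to contain the projectives and to be closed under
extensions and kernels of epimorphisms. Over `R` this is `IsWTilting.isResolving`; over `T(R)` it is
inherited through the criterion.

The second claim is the case `C₁ = R`: there `p(R, R) ≅ T(R)`, and `Add` is the class of projectives
on both sides. -/

/-! ### Short exact sequences and extension of maps to a class of modules. -/

section ShortExact

variable {R : Type u} [Ring R]
variable {X Y Z : Type u} [AddCommGroup X] [Module R X] [AddCommGroup Y] [Module R Y]
  [AddCommGroup Z] [Module R Z]

/-- `0 → X → Y → Z → 0` is exact. -/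
structure IsSES (i : X →ₗ[R] Y) (q : Y →ₗ[R] Z) : Prop where
  inj : Function.Injective i
  exact : Function.Exact i q
  surj : Function.Surjective q

theorem IsSES.comp_apply {i : X →ₗ[R] Y} {q : Y →ₗ[R] Z} (h : IsSES i q) (x : X) :
    q (i x) = 0 := (h.exact (i x)).2 ⟨x, rfl⟩

theorem IsSES.mkQ {i : X →ₗ[R] Y} (h : Function.Injective i) :
    IsSES i (LinearMap.range i).mkQ :=
  ⟨h, LinearMap.exact_map_mkQ_range i, Submodule.mkQ_surjective _⟩

theorem IsSES.ker {q : Y →ₗ[R] Z} (h : Function.Surjective q) :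
    IsSES (LinearMap.ker q).subtype q :=
  ⟨Submodule.injective_subtype _, LinearMap.exact_subtype_ker_map q, h⟩

theorem IsSES.exists_lift {i : X →ₗ[R] Y} {q : Y →ₗ[R] Z} (h : IsSES i q)
    {W : Type u} [AddCommGroup W] [Module R W] (f : W →ₗ[R] Y) (hf : ∀ w, q (f w) = 0) :
    ∃ k : W →ₗ[R] X, ∀ w, i (k w) = f w := by
  let e := LinearEquiv.ofInjective i h.inj
  refine ⟨e.symm.toLinearMap ∘ₗ f.codRestrict (LinearMap.range i)
    (fun w => (h.exact _).1 (hf w)), fun w => ?_⟩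
  have := congrArg Subtype.val (e.apply_symm_apply
    (f.codRestrict (LinearMap.range i) (fun w => (h.exact _).1 (hf w)) w))
  exact this

/-- Factorization of a linear map through a surjection. -/
theorem LinearMap.exists_factor_of_surjective {q : Y →ₗ[R] Z} (h : Function.Surjective q)
    {W : Type u} [AddCommGroup W] [Module R W] (f : Y →ₗ[R] W) (hf : ∀ y, q y = 0 → f y = 0) :
    ∃ k : Z →ₗ[R] W, ∀ y, k (q y) = f y := by
  let e := q.quotKerEquivOfSurjective h
  refine ⟨(LinearMap.ker q).liftQ f (fun y hy => hf y hy) ∘ₗ e.symm.toLinearMap, fun y => ?_⟩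
  have : e.symm (q y) = (LinearMap.ker q).mkQ y := by
    rw [LinearEquiv.symm_apply_eq]; rfl
  rw [LinearMap.comp_apply, LinearEquiv.coe_coe, this]
  rfl

theorem IsSES.exists_desc {i : X →ₗ[R] Y} {q : Y →ₗ[R] Z} (h : IsSES i q)
    {W : Type u} [AddCommGroup W] [Module R W] (f : Y →ₗ[R] W) (hf : ∀ x, f (i x) = 0) :
    ∃ k : Z →ₗ[R] W, ∀ y, k (q y) = f y :=
  LinearMap.exists_factor_of_surjective h.surj f fun y hy => by
    obtain ⟨x, rfl⟩ := (h.exact y).1 hy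
    exact hf x

/-- Every map from `X` to a module in `𝓕` extends along `i`. -/
def ExtendsAlong (𝓕 : ModuleCat.{u} R → Prop) (i : X →ₗ[R] Y) : Prop :=
  ∀ F : ModuleCat.{u} R, 𝓕 F → ∀ h : X →ₗ[R] F, ∃ k : Y →ₗ[R] F, ∀ x, k (i x) = h x

theorem IsHomExactAt.extendsAlong {𝓕 : ModuleCat.{u} R → Prop} {f : X →ₗ[R] Y} {g : Y →ₗ[R] Z}
    (h : IsHomExactAt 𝓕 f g) : ExtendsAlong 𝓕 (LinearMap.range g).subtype := by
  intro F hF t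
  obtain ⟨k, hk⟩ := (h.2 F hF (t ∘ₗ g.rangeRestrict)).1 (by
    ext x
    have : g.rangeRestrict (f x) = 0 := Subtype.ext ((h.1 (f x)).2 ⟨x, rfl⟩)
    simp [this])
  refine ⟨k, ?_⟩
  rintro ⟨_, y, rfl⟩
  exact LinearMap.congr_fun hk y

theorem IsHomExactAt.of_range_eq {𝓕 : ModuleCat.{u} R → Prop} {f : X →ₗ[R] Y} {g : Y →ₗ[R] Z}
    (h : IsHomExactAt 𝓕 f g) {X' : Type u} [AddCommGroup X'] [Module R X'] {f' : X' →ₗ[R] Y}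
    (hf : LinearMap.range f' = LinearMap.range f) : IsHomExactAt 𝓕 f' g := by
  have key : ∀ y, y ∈ Set.range f' ↔ y ∈ Set.range f := fun y => by
    rw [← LinearMap.coe_range, ← LinearMap.coe_range, hf]
  refine ⟨fun y => (h.1 y).trans (key y).symm, fun F hF t => ?_⟩
  rw [← h.2 F hF t]
  simp only [LinearMap.ext_iff, LinearMap.comp_apply, LinearMap.zero_apply]
  constructor
  · intro H x
    obtain ⟨x', hx'⟩ := (key _).2 ⟨x, rfl⟩
    rw [← hx', H]
  · intro H x
    obtain ⟨x', hx'⟩ := (key _).1 ⟨x, rfl⟩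
    rw [← hx', H]

/-- Only the outgoing inclusion `z` needs an extension property: a map on `Y` that vanishes on `K`
factors through `L` by exactness, and what remains is to extend it from `L` to `Z`. -/
theorem IsHomExactAt.splice {𝓕 : ModuleCat.{u} R → Prop} {K L : Type u}
    [AddCommGroup K] [Module R K] [AddCommGroup L] [Module R L]
    {a : X →ₗ[R] K} {v : K →ₗ[R] Y} {w : Y →ₗ[R] L} {z : L →ₗ[R] Z}
    (ha : Function.Surjective a) (hvw : IsSES v w) (hz : Function.Injective z)
    (hext : ExtendsAlong 𝓕 z) : IsHomExactAt 𝓕 (v ∘ₗ a) (z ∘ₗ w) := by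
  refine ⟨fun y => ?_, fun F hF t => ?_⟩
  · rw [LinearMap.comp_apply, map_eq_zero_iff z hz, hvw.exact y]
    constructor
    · rintro ⟨k, rfl⟩
      obtain ⟨x, rfl⟩ := ha k
      exact ⟨x, rfl⟩
    · rintro ⟨x, rfl⟩
      exact ⟨a x, rfl⟩
  · constructor
    · intro ht
      obtain ⟨s, hs⟩ := hvw.exists_desc t (fun k => by
        obtain ⟨x, rfl⟩ := ha k
        exact LinearMap.congr_fun ht x)
      obtain ⟨r, hr⟩ := hext F hF s
      exact ⟨r, LinearMap.ext fun y => (hr _).trans (hs y)⟩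
    · rintro ⟨r, rfl⟩
      ext x
      simp [hvw.comp_apply]

end ShortExact

/-! ### Complete resolutions, cut into one-step conditions. -/

section CompleteResolution

variable {R : Type u} [Ring R]

/-- `X` is a quotient of a projective module with kernel in `𝓧`, `Hom(-, 𝓕)`-exactly. -/
def LeftStep (𝓕 𝓧 : ModuleCat.{u} R → Prop) (X : ModuleCat.{u} R) : Prop :=
  ∃ (K P : ModuleCat.{u} R) (i : K →ₗ[R] P) (q : P →ₗ[R] X),
    Module.Projective R P ∧ 𝓧 K ∧ IsSES i q ∧ ExtendsAlong 𝓕 i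

/-- `X` embeds in a module of `𝓕` with cokernel in `𝓧`, `Hom(-, 𝓕)`-exactly. -/
def RightStep (𝓕 𝓧 : ModuleCat.{u} R → Prop) (X : ModuleCat.{u} R) : Prop :=
  ∃ (A N : ModuleCat.{u} R) (j : X →ₗ[R] A) (q : A →ₗ[R] N),
    𝓕 A ∧ 𝓧 N ∧ IsSES j q ∧ ExtendsAlong 𝓕 j

/-- `M` has a `Hom(-, 𝓕)`-exact projective resolution with all kernels extending maps to `𝓕`. -/
def HasLeftResolution (𝓕 : ModuleCat.{u} R → Prop) (M : ModuleCat.{u} R) : Prop :=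
  ∃ 𝓧 : ModuleCat.{u} R → Prop, 𝓧 M ∧ ∀ X, 𝓧 X → LeftStep 𝓕 𝓧 X

/-- `M` has a `Hom(-, 𝓕)`-exact coresolution by modules in `𝓕`. -/
def HasRightResolution (𝓕 : ModuleCat.{u} R → Prop) (M : ModuleCat.{u} R) : Prop :=
  ∃ 𝓧 : ModuleCat.{u} R → Prop, 𝓧 M ∧ ∀ X, 𝓧 X → RightStep 𝓕 𝓧 X

variable {𝓕 : ModuleCat.{u} R → Prop} {M : ModuleCat.{u} R}

/-- The modules with a left resolution form the largest class closed under the one-step condition,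
so the kernel can again be taken in it. Existence of infinite resolutions thus becomes a coinductive
property. -/
theorem HasLeftResolution.step (h : HasLeftResolution 𝓕 M) :
    LeftStep 𝓕 (HasLeftResolution 𝓕) M := by
  obtain ⟨𝓧, hM, H⟩ := h
  obtain ⟨K, P, i, q, hP, hK, hs, he⟩ := H M hM
  exact ⟨K, P, i, q, hP, ⟨𝓧, hK, H⟩, hs, he⟩

theorem HasRightResolution.step (h : HasRightResolution 𝓕 M) :
    RightStep 𝓕 (HasRightResolution 𝓕) M := by
  obtain ⟨𝓧, hM, H⟩ := h
  obtain ⟨A, N, j, q, hA, hN, hs, he⟩ := H M hM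
  exact ⟨A, N, j, q, hA, ⟨𝓧, hN, H⟩, hs, he⟩

theorem HasCompleteResolution.of_left_right (hl : HasLeftResolution 𝓕 M)
    (hr : HasRightResolution 𝓕 M) : HasCompleteResolution 𝓕 M := by
  have hl' := fun X : {X : ModuleCat.{u} R // HasLeftResolution 𝓕 X} => X.2.step
  have hr' := fun X : {X : ModuleCat.{u} R // HasRightResolution 𝓕 X} => X.2.step
  unfold LeftStep at hl'
  unfold RightStep at hr'
  choose K P i q hP hK hs he using hl'
  choose A N j r hA hN ht hf using hr'
  -- The chosen steps are iterated from `M`: `k` lists the successive syzygies and `c` the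
  -- successive cosyzygies.
  let k : ℕ → {X : ModuleCat.{u} R // HasLeftResolution 𝓕 X} :=
    fun n => Nat.rec ⟨M, hl⟩ (fun _ X => ⟨K X, hK X⟩) n
  let c : ℕ → {X : ModuleCat.{u} R // HasRightResolution 𝓕 X} :=
    fun n => Nat.rec ⟨M, hr⟩ (fun _ X => ⟨N X, hN X⟩) n
  refine ⟨fun n => P (k n), fun n => A (c n), fun n => i (k n) ∘ₗ q (k (n + 1)),
    j (c 0) ∘ₗ q (k 0), fun n => j (c (n + 1)) ∘ₗ r (c n), fun n => hP _, fun n => hA _,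
    fun n => ?_, ?_, ?_, fun n => ?_, ?_⟩
  · exact IsHomExactAt.splice (hs (k (n + 2))).surj (hs (k (n + 1))) (hs (k n)).inj (he _)
  · exact IsHomExactAt.splice (hs (k 1)).surj (hs (k 0)) (ht (c 0)).inj (hf _)
  · exact IsHomExactAt.splice (hs (k 0)).surj (ht (c 0)) (ht (c 1)).inj (hf _)
  · exact IsHomExactAt.splice (ht (c n)).surj (ht (c (n + 1))) (ht (c (n + 2))).inj (hf _)
  · have : LinearMap.range (j (c 0) ∘ₗ q (k 0)) = LinearMap.range (j (c 0)) :=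
      LinearMap.range_comp_of_range_eq_top _ (LinearMap.range_eq_top.2 (hs (k 0)).surj)
    exact ⟨(LinearEquiv.ofInjective (j (c 0)) (ht (c 0)).inj).trans (LinearEquiv.ofEq _ _ this.symm)⟩

theorem HasLeftResolution.of_complex (P : ℕ → ModuleCat.{u} R)
    (p : ∀ n, P (n + 1) →ₗ[R] P n) (e : P 0 →ₗ[R] M) (hP : ∀ n, Module.Projective R (P n))
    (hp : ∀ n, IsHomExactAt 𝓕 (p (n + 1)) (p n)) (hpe : Function.Exact (p 0) e)
    (he : Function.Surjective e) : HasLeftResolution 𝓕 M := by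
  refine ⟨fun X => ∃ (P : ℕ → ModuleCat.{u} R) (p : ∀ n, P (n + 1) →ₗ[R] P n) (e : P 0 →ₗ[R] X),
    (∀ n, Module.Projective R (P n)) ∧ (∀ n, IsHomExactAt 𝓕 (p (n + 1)) (p n)) ∧
    Function.Exact (p 0) e ∧ Function.Surjective e, ⟨P, p, e, hP, hp, hpe, he⟩, ?_⟩
  rintro X ⟨P, p, e, hP, hp, hpe, he⟩
  refine ⟨ModuleCat.of R (LinearMap.range (p 0)), P 0, (LinearMap.range (p 0)).subtype, e, hP 0,
    ⟨fun n => P (n + 1), fun n => p (n + 1), (p 0).rangeRestrict, fun n => hP _, fun n => hp _,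
      fun y => ?_, LinearMap.surjective_rangeRestrict _⟩,
    ⟨Submodule.injective_subtype _, fun y => ?_, he⟩, (hp 0).extendsAlong⟩
  · rw [← (hp 0).1 y, Subtype.ext_iff]
    rfl
  · rw [hpe y]
    simp

theorem HasRightResolution.of_complex (A : ℕ → ModuleCat.{u} R)
    (a : ∀ n, A n →ₗ[R] A (n + 1)) (j : M →ₗ[R] A 0) (hA : ∀ n, 𝓕 (A n))
    (ha : ∀ n, IsHomExactAt 𝓕 (a n) (a (n + 1))) (hja : IsHomExactAt 𝓕 j (a 0))
    (hj : Function.Injective j) (hext : ExtendsAlong 𝓕 j) : HasRightResolution 𝓕 M := by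
  refine ⟨fun X => ∃ (A : ℕ → ModuleCat.{u} R) (a : ∀ n, A n →ₗ[R] A (n + 1)) (j : X →ₗ[R] A 0),
    (∀ n, 𝓕 (A n)) ∧ (∀ n, IsHomExactAt 𝓕 (a n) (a (n + 1))) ∧ IsHomExactAt 𝓕 j (a 0) ∧
    Function.Injective j ∧ ExtendsAlong 𝓕 j, ⟨A, a, j, hA, ha, hja, hj, hext⟩, ?_⟩
  rintro X ⟨A, a, j, hA, ha, hja, hj, hext⟩
  refine ⟨A 0, ModuleCat.of R (LinearMap.range (a 0)), j, (a 0).rangeRestrict, hA 0,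
    ⟨fun n => A (n + 1), fun n => a (n + 1), (LinearMap.range (a 0)).subtype, fun n => hA _,
      fun n => ha _, (ha 0).of_range_eq (Submodule.range_subtype _),
      Submodule.injective_subtype _, hja.extendsAlong⟩,
    ⟨hj, fun y => ?_, LinearMap.surjective_rangeRestrict _⟩, hext⟩
  rw [← hja.1 y, Subtype.ext_iff]
  rfl

/-- A complete resolution is cut at the image of `P₀ → A⁰`; conversely, the two halves are spliced
along `M`. -/
theorem hasCompleteResolution_iff :
    HasCompleteResolution 𝓕 M ↔ HasLeftResolution 𝓕 M ∧ HasRightResolution 𝓕 M := by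
  refine ⟨?_, fun h => .of_left_right h.1 h.2⟩
  rintro ⟨P, A, p, d, a, hP, hA, hp, hpd, hda, ha, ⟨e⟩⟩
  constructor
  · refine .of_complex P p (e.symm.toLinearMap ∘ₗ d.rangeRestrict) hP hp (fun y => ?_)
      (e.symm.surjective.comp (LinearMap.surjective_rangeRestrict _))
    rw [← hpd.1 y, LinearMap.comp_apply, LinearEquiv.coe_coe, e.symm.map_eq_zero_iff,
      Subtype.ext_iff]
    rfl
  · refine .of_complex A a ((LinearMap.range d).subtype ∘ₗ e.toLinearMap) hA ha
      (hda.of_range_eq ?_) ((Submodule.injective_subtype _).comp e.injective) ?_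
    · rw [LinearMap.range_comp_of_range_eq_top _ e.range, Submodule.range_subtype]
    · intro F hF h
      obtain ⟨k, hk⟩ := hpd.extendsAlong F hF (h ∘ₗ e.symm.toLinearMap)
      exact ⟨k, fun x => by simpa using hk (e x)⟩

end CompleteResolution

/-! ### Resolving classes and dimension shifting. -/

section Resolving

variable {R : Type u} [Ring R]

/-- A class of modules which contains the projective modules and is closed under extensions and
kernels of epimorphisms. -/
structure IsResolving (𝓖 : ModuleCat.{u} R → Prop) : Prop where
  proj : ∀ P : ModuleCat.{u} R, Module.Projective R P → 𝓖 P
  ext : ∀ {X Y Z : ModuleCat.{u} R} {i : X →ₗ[R] Y} {q : Y →ₗ[R] Z}, IsSES i q → 𝓖 X → 𝓖 Z → 𝓖 Y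
  ker : ∀ {X Y Z : ModuleCat.{u} R} {i : X →ₗ[R] Y} {q : Y →ₗ[R] Z}, IsSES i q → 𝓖 Y → 𝓖 Z → 𝓖 X

variable {𝓖 : ModuleCat.{u} R → Prop}

/-- An isomorphism is a short exact sequence with zero third term, so closure under extensions or
kernels also transports membership along isomorphisms. -/
theorem isSES_equiv {X Y : Type u} [AddCommGroup X] [Module R X] [AddCommGroup Y] [Module R Y]
    (e : X ≃ₗ[R] Y) : IsSES e.toLinearMap (0 : Y →ₗ[R] PUnit.{u + 1}) :=
  ⟨e.injective, fun y => ⟨fun _ => ⟨e.symm y, e.apply_symm_apply y⟩, fun _ => rfl⟩,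
    fun _ => ⟨0, rfl⟩⟩

theorem IsResolving.of_equiv (h𝓖 : IsResolving 𝓖) {X Y : ModuleCat.{u} R} (e : X ≃ₗ[R] Y)
    (hX : 𝓖 X) : 𝓖 Y :=
  h𝓖.ext (Z := ModuleCat.of R PUnit) (isSES_equiv e) hX (h𝓖.proj _ inferInstance)

theorem HasResolutionOfLength.of_equiv {X Y : ModuleCat.{u} R} {n : ℕ} (e : X ≃ₗ[R] Y)
    (h : HasResolutionOfLength 𝓖 X n) : HasResolutionOfLength 𝓖 Y n := by
  obtain ⟨G, g, q, h1, h2, h3, h4, h5⟩ := h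
  refine ⟨G, g, e.toLinearMap ∘ₗ q, h1, h2, e.surjective.comp h3, fun y => ?_, h5⟩
  rw [← h4 y, LinearMap.comp_apply, LinearEquiv.coe_coe, e.map_eq_zero_iff]

theorem IsResolving.hasResolutionOfLength_zero (h𝓖 : IsResolving 𝓖) {X : ModuleCat.{u} R} :
    HasResolutionOfLength 𝓖 X 0 ↔ 𝓖 X := by
  constructor
  · rintro ⟨G, g, q, h1, h2, h3, h4, h5⟩
    refine h𝓖.of_equiv (LinearEquiv.ofBijective q ⟨?_, h3⟩) (h1 0 le_rfl)
    rw [injective_iff_map_eq_zero]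
    intro y hy
    obtain ⟨x, rfl⟩ := (h4 y).1 hy
    have := h2 1 one_pos
    rw [Subsingleton.elim x 0, map_zero]
  · intro hX
    let G : ℕ → ModuleCat.{u} R := fun | 0 => X | _ + 1 => ModuleCat.of R PUnit
    refine ⟨G, fun _ => 0, (LinearMap.id : X →ₗ[R] X), ?_, ?_, Function.surjective_id, ?_, ?_⟩
    · intro i hi
      obtain rfl : i = 0 := by omega
      exact hX
    · rintro (_ | i) hi
      · omega
      · exact inferInstanceAs (Subsingleton PUnit)
    · exact fun y => ⟨fun h => ⟨0, (map_zero _).trans h.symm⟩, by rintro ⟨x, rfl⟩; rfl⟩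
    · exact fun i y => ⟨fun h => ⟨0, Subsingleton.elim (α := PUnit) _ _⟩, fun _ => rfl⟩

theorem hasResolutionOfLength_succ {X : ModuleCat.{u} R} {n : ℕ} :
    HasResolutionOfLength 𝓖 X (n + 1) ↔ ∃ (K G : ModuleCat.{u} R) (i : K →ₗ[R] G)
      (q : G →ₗ[R] X), 𝓖 G ∧ HasResolutionOfLength 𝓖 K n ∧ IsSES i q := by
  constructor
  · rintro ⟨G, g, q, h1, h2, h3, h4, h5⟩
    refine ⟨ModuleCat.of R (LinearMap.range (g 0)), G 0, (LinearMap.range (g 0)).subtype, q,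
      h1 0 (Nat.zero_le _), ⟨fun n => G (n + 1), fun n => g (n + 1), (g 0).rangeRestrict,
        fun i hi => h1 _ (by omega), fun i hi => h2 _ (by omega),
        LinearMap.surjective_rangeRestrict _, fun y => ?_, fun i => h5 _⟩,
      ⟨Submodule.injective_subtype _, fun y => ?_, h3⟩⟩
    · rw [← h5 0 y, Subtype.ext_iff]
      rfl
    · rw [h4 y]
      simp
  · rintro ⟨K, G₀, i, q, hG, ⟨G, g, e, h1, h2, h3, h4, h5⟩, hs⟩
    let G' : ℕ → ModuleCat.{u} R := fun | 0 => G₀ | n + 1 => G n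
    let g' : ∀ n, G' (n + 1) →ₗ[R] G' n := fun | 0 => i ∘ₗ e | n + 1 => g n
    refine ⟨G', g', q, ?_, ?_, hs.surj, ?_, ?_⟩
    · rintro (_ | m) hm
      · exact hG
      · exact h1 m (by omega)
    · rintro (_ | m) hm
      · omega
      · exact h2 m (by omega)
    · intro y
      rw [hs.exact y]
      constructor
      · rintro ⟨k, rfl⟩
        obtain ⟨x, rfl⟩ := h3 k
        exact ⟨x, rfl⟩
      · rintro ⟨x, rfl⟩
        exact ⟨e x, rfl⟩
    · rintro (_ | m)
      · intro y
        refine Iff.trans ?_ (h4 y)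
        exact map_eq_zero_iff i hs.inj
      · exact h5 m

theorem HasResolutionOfLength.succ (h𝓖 : IsResolving 𝓖) {n : ℕ} {X : ModuleCat.{u} R}
    (h : HasResolutionOfLength 𝓖 X n) : HasResolutionOfLength 𝓖 X (n + 1) := by
  induction n generalizing X with
  | zero =>
    refine hasResolutionOfLength_succ.2 ⟨ModuleCat.of R PUnit, X, 0, LinearMap.id,
      h𝓖.hasResolutionOfLength_zero.1 h,
      h𝓖.hasResolutionOfLength_zero.2 (h𝓖.proj _ inferInstance), fun _ _ _ => rfl, fun y => ?_,
      Function.surjective_id⟩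
    exact ⟨fun h => ⟨0, (map_zero _).trans h.symm⟩, by rintro ⟨x, rfl⟩; rfl⟩
  | succ n ih =>
    obtain ⟨K, G, i, q, hG, hK, hs⟩ := hasResolutionOfLength_succ.1 h
    exact hasResolutionOfLength_succ.2 ⟨K, G, i, q, hG, ih hK, hs⟩

theorem HasResolutionOfLength.mono (h𝓖 : IsResolving 𝓖) {m n : ℕ} (hmn : m ≤ n)
    {X : ModuleCat.{u} R} (h : HasResolutionOfLength 𝓖 X m) : HasResolutionOfLength 𝓖 X n := by
  induction hmn with
  | refl => exact h
  | step _ ih => exact ih.succ h𝓖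

/-- Possible lengths are upward closed by padding with zero, so the infimum is bounded by `n` only
if `n` itself is a possible length. -/
theorem IsResolving.resolutionDim_le (h𝓖 : IsResolving 𝓖) {X : ModuleCat.{u} R} {n : ℕ} :
    resolutionDim 𝓖 X ≤ n ↔ HasResolutionOfLength 𝓖 X n := by
  refine ⟨fun h => ?_, fun h => iInf₂_le n h⟩
  by_contra hn
  have : ((n + 1 : ℕ) : ℕ∞) ≤ resolutionDim 𝓖 X := by
    refine le_iInf₂ fun m hm => ?_
    by_contra hlt
    exact hn (hm.mono h𝓖 (by rw [Nat.cast_le] at hlt; omega))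
  have := this.trans h
  rw [Nat.cast_le] at this
  omega

theorem HasResolutionOfLength.ker (h𝓖 : IsResolving 𝓖) {n : ℕ} {X Y Z : ModuleCat.{u} R}
    {i : X →ₗ[R] Y} {q : Y →ₗ[R] Z} (hs : IsSES i q) (hY : HasResolutionOfLength 𝓖 Y n)
    (hZ : 𝓖 Z) : HasResolutionOfLength 𝓖 X n := by
  cases n with
  | zero =>
    rw [h𝓖.hasResolutionOfLength_zero] at hY ⊢
    exact h𝓖.ker hs hY hZ
  | succ n =>
    obtain ⟨K, G, j, r, hG, hK, ht⟩ := hasResolutionOfLength_succ.1 hY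
    -- The preimage `L` of `X` in `G` is the kernel of `G → Z`, hence in `𝓖`, and `0 → K → L → X →
    -- 0` is exact with the old kernel `K`.
    have hL : 𝓖 (ModuleCat.of R (LinearMap.ker (q ∘ₗ r))) :=
      h𝓖.ker (Y := G) (IsSES.ker (hs.surj.comp ht.surj)) hG hZ
    obtain ⟨s, hs'⟩ := hs.exists_lift (r ∘ₗ (LinearMap.ker (q ∘ₗ r)).subtype) (fun w => w.2)
    have hj : ∀ k, q (r (j k)) = 0 := fun k => by rw [ht.comp_apply, map_zero]
    refine hasResolutionOfLength_succ.2 ⟨K, ModuleCat.of R (LinearMap.ker (q ∘ₗ r)),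
      j.codRestrict _ hj, s, hL, hK, ⟨?_, ?_, ?_⟩⟩
    · exact fun a b hab => ht.inj (congrArg Subtype.val hab)
    · intro y
      rw [← map_eq_zero_iff i hs.inj, hs']
      refine (ht.exact y.1).trans ?_
      exact ⟨fun ⟨x, hx⟩ => ⟨x, Subtype.ext hx⟩, fun ⟨x, hx⟩ => ⟨x, congrArg Subtype.val hx⟩⟩
    · intro x
      obtain ⟨g, hg⟩ := ht.surj (i x)
      refine ⟨⟨g, ?_⟩, hs.inj ?_⟩
      · change q (r g) = 0
        rw [hg, hs.comp_apply]
      · rw [hs']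
        exact hg

theorem HasResolutionOfLength.prod_projective (h𝓖 : IsResolving 𝓖) {n : ℕ}
    {X P : ModuleCat.{u} R} (hX : HasResolutionOfLength 𝓖 X n) (hP : Module.Projective R P) :
    HasResolutionOfLength 𝓖 (ModuleCat.of R (X × P)) n := by
  have hprod : ∀ G : ModuleCat.{u} R, 𝓖 G → 𝓖 (ModuleCat.of R (G × P)) := fun G hG =>
    h𝓖.ext (X := G) (Z := P) (i := LinearMap.inl R G P) (q := LinearMap.snd R G P)
      ⟨LinearMap.inl_injective, .inl_snd, LinearMap.snd_surjective⟩ hG (h𝓖.proj _ hP)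
  cases n with
  | zero =>
    rw [h𝓖.hasResolutionOfLength_zero] at hX ⊢
    exact hprod X hX
  | succ n =>
    obtain ⟨K, G, j, r, hG, hK, ht⟩ := hasResolutionOfLength_succ.1 hX
    refine hasResolutionOfLength_succ.2 ⟨K, ModuleCat.of R (G × P), LinearMap.inl R G P ∘ₗ j,
      r.prodMap LinearMap.id, hprod G hG, hK, ?_, ?_, ht.surj.prodMap Function.surjective_id⟩
    · exact LinearMap.inl_injective.comp ht.inj
    · rintro ⟨g, p⟩
      change (r g, p) = 0 ↔ _
      rw [Prod.mk_eq_zero, ht.exact g]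
      constructor
      · rintro ⟨⟨k, rfl⟩, rfl⟩
        exact ⟨k, rfl⟩
      · rintro ⟨k, hk⟩
        obtain ⟨h1, h2⟩ := Prod.ext_iff.1 hk
        exact ⟨⟨k, h1⟩, h2.symm⟩

/-- A Schanuel-type comparison: any projective presentation may replace the first step of a given
resolution. This makes the dimension of a syzygy independent of choices. -/
theorem IsResolving.hasResolutionOfLength_succ_iff (h𝓖 : IsResolving 𝓖) {n : ℕ}
    {K P X : ModuleCat.{u} R} (hP : Module.Projective R P) {i : K →ₗ[R] P} {q : P →ₗ[R] X}
    (hs : IsSES i q) :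
    HasResolutionOfLength 𝓖 X (n + 1) ↔ HasResolutionOfLength 𝓖 K n := by
  refine ⟨fun h => ?_,
    fun h => hasResolutionOfLength_succ.2 ⟨K, P, i, q, h𝓖.proj P hP, h, hs⟩⟩
  obtain ⟨L, G, j, r, hG, hL, ht⟩ := hasResolutionOfLength_succ.1 h
  obtain ⟨l, hl⟩ := Module.projective_lifting_property r q ht.surj
  have hl' : ∀ p, r (l p) = q p := LinearMap.congr_fun hl
  obtain ⟨s, hs'⟩ := ht.exists_lift (l ∘ₗ i) (fun k => by
    rw [LinearMap.comp_apply, hl', hs.comp_apply])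
  -- The lift `l : P → G` induces `s : K → L`, giving the exact sequence `0 → K → L × P → G → 0`.
  -- The sign on `s` makes the composite vanish.
  refine HasResolutionOfLength.ker h𝓖 (Y := ModuleCat.of R (L × P)) (Z := G)
    (i := (-s).prod i) (q := j.coprod l) ⟨?_, ?_, ?_⟩ (hL.prod_projective h𝓖 hP) hG
  · exact fun a b hab => hs.inj (congrArg Prod.snd hab)
  · rintro ⟨x, p⟩
    change j x + l p = 0 ↔ _
    constructor
    · intro h0
      have hq : q p = 0 := by
        rw [← hl', ← map_zero r, ← h0, map_add, ht.comp_apply, zero_add]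
      obtain ⟨k, rfl⟩ := (hs.exact p).1 hq
      refine ⟨k, Prod.ext ?_ rfl⟩
      apply ht.inj
      change j (-s k) = j x
      rw [map_neg, hs', neg_eq_iff_add_eq_zero, add_comm]
      exact h0
    · rintro ⟨k, hk⟩
      obtain ⟨h1, h2⟩ := Prod.ext_iff.1 hk
      change -s k = x at h1
      change i k = p at h2
      rw [← h1, ← h2, map_neg, hs', LinearMap.comp_apply, neg_add_cancel]
  · intro g
    obtain ⟨p, hp⟩ := hs.surj (r g)
    obtain ⟨x, hx⟩ := (ht.exact (g - l p)).1 (by rw [map_sub, hl', hp, sub_self])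
    exact ⟨(x, p), by change j x + l p = g; rw [hx, sub_add_cancel]⟩

theorem exists_projective_presentation (X : ModuleCat.{u} R) :
    ∃ (K P : ModuleCat.{u} R) (i : K →ₗ[R] P) (q : P →ₗ[R] X),
      Module.Projective R P ∧ IsSES i q := by
  have hsurj : Function.Surjective (Finsupp.linearCombination R (id : X → X)) :=
    fun x => ⟨Finsupp.single x 1, by simp⟩
  exact ⟨ModuleCat.of R (LinearMap.ker (Finsupp.linearCombination R (id : X → X))),
    ModuleCat.of R (X →₀ R), _, _, inferInstanceAs (Module.Projective R (X →₀ R)), IsSES.ker hsurj⟩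

end Resolving

/-! ### Vanishing of Ext along short exact sequences, retracts and direct sums. -/

section ExtLemmas

open CategoryTheory CategoryTheory.Abelian

variable {R : Type u} [Ring R] {X Y Z : ModuleCat.{u} R} {i : X →ₗ[R] Y} {q : Y →ₗ[R] Z}

theorem IsSES.shortExact (h : IsSES i q) :
    (ShortComplex.mk (ModuleCat.ofHom i) (ModuleCat.ofHom q)
      (ModuleCat.hom_ext (LinearMap.ext h.comp_apply))).ShortExact :=
  ModuleCat.shortComplex_shortExact _ h.exact h.inj h.surj

theorem IsSES.subsingleton_ext_left (h : IsSES i q) (F : ModuleCat.{u} R) {n : ℕ}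
    (hY : Subsingleton (Ext Y F n)) (hZ : Subsingleton (Ext Z F (n + 1))) :
    Subsingleton (Ext X F n) := by
  refine subsingleton_of_forall_eq 0 fun x => ?_
  obtain ⟨y, rfl⟩ := Ext.contravariant_sequence_exact₁ h.shortExact F x (Nat.add_comm 1 n)
    (Subsingleton.elim (α := Ext Z F (n + 1)) _ _)
  rw [Subsingleton.elim (α := Ext Y F n) y 0]
  exact Ext.comp_zero _ _ _ _ _

theorem IsSES.subsingleton_ext_middle (h : IsSES i q) (F : ModuleCat.{u} R) {n : ℕ}
    (hX : Subsingleton (Ext X F n)) (hZ : Subsingleton (Ext Z F n)) :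
    Subsingleton (Ext Y F n) := by
  refine subsingleton_of_forall_eq 0 fun x => ?_
  obtain ⟨y, rfl⟩ := Ext.contravariant_sequence_exact₂ h.shortExact F x
    (Subsingleton.elim (α := Ext X F n) _ _)
  rw [Subsingleton.elim (α := Ext Z F n) y 0]
  exact Ext.comp_zero _ _ _ _ _

theorem IsSES.subsingleton_ext_right (h : IsSES i q) (F : ModuleCat.{u} R) {n : ℕ}
    (hX : Subsingleton (Ext X F n)) (hY : Subsingleton (Ext Y F (n + 1))) :
    Subsingleton (Ext Z F (n + 1)) := by
  refine subsingleton_of_forall_eq 0 fun x => ?_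
  obtain ⟨y, rfl⟩ := Ext.contravariant_sequence_exact₃ h.shortExact F x
    (Subsingleton.elim (α := Ext Y F (n + 1)) _ _) (Nat.add_comm 1 n)
  rw [Subsingleton.elim (α := Ext X F n) y 0]
  exact Ext.comp_zero _ _ _ _ _

theorem IsSES.exists_extension (h : IsSES i q) {F : ModuleCat.{u} R}
    (hZ : Subsingleton (Ext Z F 1)) (f : X →ₗ[R] F) : ∃ k : Y →ₗ[R] F, ∀ x, k (i x) = f x := by
  obtain ⟨y, hy⟩ := Ext.contravariant_sequence_exact₁ h.shortExact F
    (Ext.mk₀ (ModuleCat.ofHom f)) (Nat.add_comm 1 0) (Subsingleton.elim (α := Ext Z F 1) _ _)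
  obtain ⟨k, rfl⟩ := Ext.mk₀_bijective _ _ |>.2 y
  rw [Ext.mk₀_comp_mk₀] at hy
  have := (Ext.mk₀_bijective _ _).1 hy
  exact ⟨k.hom, fun x => LinearMap.congr_fun (congrArg ModuleCat.Hom.hom this) x⟩

/-- Since `Ext¹(Y, F) = 0`, every class in `Ext¹(Z, F)` is the extension class composed with some `f
: X → F`. If `f` extends over `Y`, it factors through `i`, which the extension class kills. -/
theorem IsSES.subsingleton_ext_one (h : IsSES i q) {F : ModuleCat.{u} R}
    (hY : Subsingleton (Ext Y F 1))
    (hext : ∀ f : X →ₗ[R] F, ∃ k : Y →ₗ[R] F, ∀ x, k (i x) = f x) :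
    Subsingleton (Ext Z F 1) := by
  refine subsingleton_of_forall_eq 0 fun x => ?_
  obtain ⟨y, rfl⟩ := Ext.contravariant_sequence_exact₃ h.shortExact F x
    (Subsingleton.elim (α := Ext Y F 1) _ _) (Nat.add_comm 1 0)
  obtain ⟨f, rfl⟩ := Ext.mk₀_bijective _ _ |>.2 y
  obtain ⟨k, hk⟩ := hext f.hom
  have : f = ModuleCat.ofHom i ≫ ModuleCat.ofHom k :=
    ModuleCat.hom_ext (LinearMap.ext fun x => (hk x).symm)
  rw [this, ← Ext.mk₀_comp_mk₀, ← Ext.comp_assoc_of_second_deg_zero]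
  have h0 := h.shortExact.extClass_comp
  dsimp at h0
  rw [h0, Ext.zero_comp]

theorem subsingleton_ext_of_projective {P : ModuleCat.{u} R} (hP : Module.Projective R P)
    (F : ModuleCat.{u} R) {n : ℕ} (hn : 1 ≤ n) : Subsingleton (Ext P F n) := by
  obtain ⟨n, rfl⟩ := Nat.exists_eq_add_of_le' hn
  have : Projective P := (IsProjective.iff_projective P).1 hP
  exact Ext.subsingleton_of_projective P F n

theorem subsingleton_ext_of_retract_left {s : X →ₗ[R] Y} {r : Y →ₗ[R] X} (h : ∀ x, r (s x) = x)
    (F : ModuleCat.{u} R) {n : ℕ} (hY : Subsingleton (Ext Y F n)) : Subsingleton (Ext X F n) := by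
  refine subsingleton_of_forall_eq 0 fun x => ?_
  have h1 : ModuleCat.ofHom s ≫ ModuleCat.ofHom r = 𝟙 X :=
    ModuleCat.hom_ext (LinearMap.ext h)
  rw [← Ext.mk₀_id_comp x, ← h1, ← Ext.mk₀_comp_mk₀_assoc,
    Subsingleton.elim ((Ext.mk₀ (ModuleCat.ofHom r)).comp x (zero_add n)) 0, Ext.comp_zero]

theorem subsingleton_ext_of_retract_right {s : X →ₗ[R] Y} {r : Y →ₗ[R] X} (h : ∀ x, r (s x) = x)
    (M : ModuleCat.{u} R) {n : ℕ} (hY : Subsingleton (Ext M Y n)) : Subsingleton (Ext M X n) := by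
  refine subsingleton_of_forall_eq 0 fun x => ?_
  have h1 : ModuleCat.ofHom s ≫ ModuleCat.ofHom r = 𝟙 X :=
    ModuleCat.hom_ext (LinearMap.ext h)
  rw [← Ext.comp_mk₀_id x, ← h1, ← Ext.mk₀_comp_mk₀, ← Ext.comp_assoc_of_second_deg_zero,
    Subsingleton.elim (x.comp (Ext.mk₀ (ModuleCat.ofHom s)) (add_zero n)) 0, Ext.zero_comp]

theorem isSES_mapRange (h : IsSES i q) (I : Type u) :
    IsSES (Finsupp.mapRange.linearMap (α := I) i) (Finsupp.mapRange.linearMap (α := I) q) := by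
  refine ⟨Finsupp.mapRange_injective _ (map_zero _) h.inj, fun f => ?_,
    Finsupp.mapRange_surjective _ (map_zero _) h.surj⟩
  constructor
  · intro hf
    have : ∀ a, ∃ x, i x = f a := fun a => (h.exact _).1 (DFunLike.congr_fun hf a)
    choose g hg using this
    classical
    refine ⟨Finsupp.onFinset f.support g fun a ha => ?_, Finsupp.ext fun a => hg a⟩
    rw [Finsupp.mem_support_iff]
    intro h0
    refine ha (h.inj ?_)
    rw [hg, h0, map_zero]
  · rintro ⟨g, rfl⟩
    exact Finsupp.ext fun a => h.comp_apply _

theorem projective_finsupp {P : ModuleCat.{u} R} (hP : Module.Projective R P) (I : Type u) :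
    Module.Projective R (I →₀ P) := by
  classical
  exact .of_equiv (finsuppLEquivDirectSum R P I).symm

/-- In degree one, a map from a direct sum of kernels is extended one summand at a time; higher
degrees follow by dimension shifting. -/
theorem subsingleton_ext_finsupp (I : Type u) (F : ModuleCat.{u} R) {n : ℕ} (hn : 1 ≤ n)
    {M : ModuleCat.{u} R} (hM : Subsingleton (Ext M F n)) :
    Subsingleton (Ext (ModuleCat.of R (I →₀ M)) F n) := by
  induction n, hn using Nat.le_induction generalizing M with
  | base =>
    obtain ⟨K, P, j, r, hP, hs⟩ := exists_projective_presentation M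
    refine IsSES.subsingleton_ext_one (X := ModuleCat.of R (I →₀ K))
      (Y := ModuleCat.of R (I →₀ P)) (isSES_mapRange hs I)
      (subsingleton_ext_of_projective (projective_finsupp hP I) F le_rfl)
      fun f => ?_
    have : ∀ a : I, ∃ k : P →ₗ[R] F, ∀ x, k (j x) = f (Finsupp.single a x) := fun a =>
      hs.exists_extension hM (f ∘ₗ Finsupp.lsingle a)
    choose k hk using this
    refine ⟨Finsupp.lsum ℕ k, fun x => ?_⟩
    suffices Finsupp.lsum ℕ k ∘ₗ Finsupp.mapRange.linearMap j = f from
      LinearMap.congr_fun this x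
    refine Finsupp.lhom_ext fun a x => ?_
    simp [hk]
  | succ n hn ih =>
    obtain ⟨K, P, j, r, hP, hs⟩ := exists_projective_presentation M
    exact IsSES.subsingleton_ext_right (X := ModuleCat.of R (I →₀ K))
      (Y := ModuleCat.of R (I →₀ P)) (isSES_mapRange hs I) F
      (ih (hs.subsingleton_ext_left F (subsingleton_ext_of_projective hP F hn) hM))
      (subsingleton_ext_of_projective (projective_finsupp hP I) F
        (by omega))

end ExtLemmas

/-! ### The class `Add(C)` as retracts of direct sums of copies of `C`. -/

section InAdd

variable {R : Type u} [Ring R] {C : Type u} [AddCommGroup C] [Module R C]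

theorem inAdd_iff {M : ModuleCat.{u} R} : InAdd R C M ↔
    ∃ (I : Type u) (s : M →ₗ[R] (I →₀ C)) (r : (I →₀ C) →ₗ[R] M), ∀ x, r (s x) = x := by
  constructor
  · rintro ⟨I, N, ⟨e⟩⟩
    exact ⟨I, e.toLinearMap ∘ₗ LinearMap.inl R M N, LinearMap.fst R M N ∘ₗ e.symm.toLinearMap,
      fun x => by simp⟩
  · rintro ⟨I, s, r, h⟩
    refine ⟨I, ModuleCat.of R (LinearMap.ker r), ⟨LinearEquiv.ofBijective
      (s.coprod (LinearMap.ker r).subtype) ⟨?_, fun y => ?_⟩⟩⟩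
    · rw [injective_iff_map_eq_zero]
      rintro ⟨m, n⟩ hmn
      replace hmn : s m + n.1 = 0 := hmn
      have hn : r n.1 = 0 := n.2
      have hm : m = 0 := by
        rw [← h m, ← map_zero r, ← hmn, map_add, hn, add_zero]
      subst hm
      rw [map_zero, zero_add] at hmn
      exact Prod.ext rfl (Subtype.ext hmn)
    · refine ⟨(r y, ⟨y - s (r y), ?_⟩), ?_⟩
      · rw [LinearMap.mem_ker, map_sub, h, sub_self]
      · change s (r y) + (y - s (r y)) = y
        abel

theorem InAdd.of_retract {M N : ModuleCat.{u} R} (hN : InAdd R C N) (s : M →ₗ[R] N)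
    (r : N →ₗ[R] M) (h : ∀ x, r (s x) = x) : InAdd R C M := by
  obtain ⟨I, s', r', h'⟩ := inAdd_iff.1 hN
  exact inAdd_iff.2 ⟨I, s' ∘ₗ s, r ∘ₗ r', fun x => by simp [h', h]⟩

theorem inAdd_finsupp (I : Type u) : InAdd R C (ModuleCat.of R (I →₀ C)) :=
  inAdd_iff.2 ⟨I, LinearMap.id, LinearMap.id, fun _ => rfl⟩

theorem InAdd.finsupp {M : ModuleCat.{u} R} (hM : InAdd R C M) (I : Type u) :
    InAdd R C (ModuleCat.of R (I →₀ M)) := by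
  obtain ⟨J, s, r, h⟩ := inAdd_iff.1 hM
  refine inAdd_iff.2 ⟨I × J, (Finsupp.curryLinearEquiv R).symm.toLinearMap ∘ₗ
    Finsupp.mapRange.linearMap s, Finsupp.mapRange.linearMap r ∘ₗ
    (Finsupp.curryLinearEquiv R).toLinearMap, fun x => ?_⟩
  ext a
  simp [h]

theorem InAdd.prod {M N : ModuleCat.{u} R} (hM : InAdd R C M) (hN : InAdd R C N) :
    InAdd R C (ModuleCat.of R (M × N)) := by
  obtain ⟨I, s, r, h⟩ := inAdd_iff.1 hM
  obtain ⟨J, s', r', h'⟩ := inAdd_iff.1 hN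
  refine inAdd_iff.2 ⟨I ⊕ J, (Finsupp.sumFinsuppLEquivProdFinsupp R).symm.toLinearMap ∘ₗ
    s.prodMap s', r.prodMap r' ∘ₗ (Finsupp.sumFinsuppLEquivProdFinsupp R).toLinearMap,
    fun x => ?_⟩
  simp [h, h']

end InAdd

/-! ### For w-tilting `C`, the `G_C`-projective modules are resolving. -/

section RelativeGorensteinClosure

open CategoryTheory.Abelian

variable {R : Type u} [Ring R] {C : Type u} [AddCommGroup C] [Module R C]

variable (R C) in
/-- `Ext^i(M, F) = 0` for all `i ≥ 1` and all `F` in `Add(C)`. -/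
def ExtVanishing (M : ModuleCat.{u} R) : Prop :=
  ∀ F : ModuleCat.{u} R, InAdd R C F → ∀ n : ℕ, 1 ≤ n → Subsingleton (Ext M F n)

section

variable {X Y Z : ModuleCat.{u} R} {i : X →ₗ[R] Y} {q : Y →ₗ[R] Z}

theorem ExtVanishing.of_projective (hX : Module.Projective R X) : ExtVanishing R C X :=
  fun F _ _ hn => subsingleton_ext_of_projective hX F hn

theorem ExtVanishing.of_retract (hY : ExtVanishing R C Y) {s : X →ₗ[R] Y} {r : Y →ₗ[R] X}
    (h : ∀ x, r (s x) = x) : ExtVanishing R C X :=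
  fun F hF n hn => subsingleton_ext_of_retract_left h F (hY F hF n hn)

theorem ExtVanishing.ker (hs : IsSES i q) (hY : ExtVanishing R C Y) (hZ : ExtVanishing R C Z) :
    ExtVanishing R C X :=
  fun F hF n hn => hs.subsingleton_ext_left F (hY F hF n hn) (hZ F hF _ (by omega))

theorem ExtVanishing.ext (hs : IsSES i q) (hX : ExtVanishing R C X) (hZ : ExtVanishing R C Z) :
    ExtVanishing R C Y :=
  fun F hF n hn => hs.subsingleton_ext_middle F (hX F hF n hn) (hZ F hF n hn)

theorem ExtVanishing.coker (hs : IsSES i q) (hX : ExtVanishing R C X) (hY : ExtVanishing R C Y)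
    (he : ExtendsAlong (InAdd R C) i) : ExtVanishing R C Z := by
  intro F hF n hn
  obtain ⟨n, rfl⟩ := Nat.exists_eq_add_of_le' hn
  rcases n with _ | n
  · exact hs.subsingleton_ext_one (hY F hF 1 le_rfl) (he F hF)
  · exact hs.subsingleton_ext_right F (hX F hF _ (by omega)) (hY F hF _ (by omega))

theorem ExtVanishing.extendsAlong (hs : IsSES i q) (hZ : ExtVanishing R C Z) :
    ExtendsAlong (InAdd R C) i :=
  fun F hF f => hs.exists_extension (hZ F hF 1 le_rfl) f

theorem ExtVanishing.finsupp (hX : ExtVanishing R C X) (I : Type u) :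
    ExtVanishing R C (ModuleCat.of R (I →₀ X)) :=
  fun F hF n hn => subsingleton_ext_finsupp I F hn (hX F hF n hn)

end

theorem IsWTilting.extVanishing (hC : IsWTilting R C) {A : ModuleCat.{u} R} (hA : InAdd R C A) :
    ExtVanishing R C A := by
  intro F hF n hn
  obtain ⟨I, s, r, h⟩ := inAdd_iff.1 hF
  obtain ⟨J, s', r', h'⟩ := inAdd_iff.1 hA
  exact subsingleton_ext_of_retract_right (Y := ModuleCat.of R (I →₀ C)) h A
    (subsingleton_ext_of_retract_left (Y := ModuleCat.of R (J →₀ C)) h' _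
      (subsingleton_ext_finsupp (M := ModuleCat.of R C) J _ hn (hC.1 I n hn)))

/-- Extension along a syzygy inclusion is the vanishing of `Ext¹`, and higher degrees shift to the
syzygy. In the other direction any projective presentation serves, because vanishing passes to
kernels. -/
theorem hasLeftResolution_iff_extVanishing {M : ModuleCat.{u} R} :
    HasLeftResolution (InAdd R C) M ↔ ExtVanishing R C M := by
  constructor
  · intro hM F hF n hn
    induction n, hn using Nat.le_induction generalizing M with
    | base =>
      obtain ⟨K, P, i, q, hP, -, hs, he⟩ := hM.step
      exact hs.subsingleton_ext_one (subsingleton_ext_of_projective hP F le_rfl) (he F hF)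
    | succ n hn ih =>
      obtain ⟨K, P, i, q, hP, hK, hs, -⟩ := hM.step
      exact hs.subsingleton_ext_right F (ih hK)
        (subsingleton_ext_of_projective hP F (by omega))
  · intro hM
    refine ⟨ExtVanishing R C, hM, fun X hX => ?_⟩
    obtain ⟨K, P, i, q, hP, hs⟩ := exists_projective_presentation X
    exact ⟨K, P, i, q, hP, (ExtVanishing.of_projective hP).ker hs hX, hs, hX.extendsAlong hs⟩

theorem isGCProjective_iff {M : ModuleCat.{u} R} :
    IsGCProjective R C M ↔ ExtVanishing R C M ∧ HasRightResolution (InAdd R C) M := by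
  rw [IsGCProjective, hasCompleteResolution_iff, hasLeftResolution_iff_extVanishing]

theorem IsGCProjective.extVanishing {M : ModuleCat.{u} R} (hM : IsGCProjective R C M) :
    ExtVanishing R C M := (isGCProjective_iff.1 hM).1

theorem IsGCProjective.exists_cosyzygy (hC : IsWTilting R C) {M : ModuleCat.{u} R}
    (hM : IsGCProjective R C M) : ∃ (A N : ModuleCat.{u} R) (j : M →ₗ[R] A) (q : A →ₗ[R] N),
      InAdd R C A ∧ IsGCProjective R C N ∧ IsSES j q := by
  obtain ⟨h1, h2⟩ := isGCProjective_iff.1 hM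
  obtain ⟨A, N, j, q, hA, hN, hs, he⟩ := h2.step
  exact ⟨A, N, j, q, hA,
    isGCProjective_iff.2 ⟨ExtVanishing.coker hs h1 (hC.extVanishing hA) he, hN⟩, hs⟩

/-- Only embeddings into `Add(C)` with cokernel in the same class have to be built: the vanishing of
`Ext¹` on the cokernel makes each of them `Hom(-, Add(C))`-exact. -/
theorem IsGCProjective.coinduction (𝓧 : ModuleCat.{u} R → Prop)
    (hW : ∀ X, 𝓧 X → ExtVanishing R C X)
    (hstep : ∀ X, 𝓧 X → ∃ (A N : ModuleCat.{u} R) (j : X →ₗ[R] A) (q : A →ₗ[R] N),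
      InAdd R C A ∧ 𝓧 N ∧ IsSES j q) {M : ModuleCat.{u} R} (hM : 𝓧 M) :
    IsGCProjective R C M := by
  refine isGCProjective_iff.2 ⟨hW M hM, 𝓧, hM, fun X hX => ?_⟩
  obtain ⟨A, N, j, q, hA, hN, hs⟩ := hstep X hX
  exact ⟨A, N, j, q, hA, hN, hs, (hW N hN).extendsAlong hs⟩

theorem IsGCProjective.of_cosyzygy (hC : IsWTilting R C) {M A N : ModuleCat.{u} R}
    {j : M →ₗ[R] A} {q : A →ₗ[R] N} (hs : IsSES j q) (hA : InAdd R C A)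
    (hN : IsGCProjective R C N) : IsGCProjective R C M := by
  have hM : ExtVanishing R C M := .ker hs (hC.extVanishing hA) hN.extVanishing
  refine isGCProjective_iff.2 ⟨hM, fun X => X = M ∨ HasRightResolution (InAdd R C) X,
    Or.inl rfl, fun X hX => ?_⟩
  rcases hX with rfl | hX
  · exact ⟨A, N, j, q, hA, Or.inr (isGCProjective_iff.1 hN).2, hs, hN.extVanishing.extendsAlong hs⟩
  · obtain ⟨A, N, j, q, hA, hN, hs, he⟩ := hX.step
    exact ⟨A, N, j, q, hA, Or.inr hN, hs, he⟩

/-- If `X` and `Z` embed in `A` and `B`, every extension of `Z` by `X` embeds in `A × B` with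
cokernel an extension of the cokernels, as soon as the embedding of `X` extends. -/
theorem IsSES.horseshoe {X Y Z A B X' Z' : ModuleCat.{u} R} {i : X →ₗ[R] Y} {q : Y →ₗ[R] Z}
    (hs : IsSES i q) {a : X →ₗ[R] A} {a' : A →ₗ[R] X'} (ha : IsSES a a')
    {b : Z →ₗ[R] B} {b' : B →ₗ[R] Z'} (hb : IsSES b b') {t : Y →ₗ[R] A}
    (ht : ∀ x, t (i x) = a x) :
    ∃ (Y' : ModuleCat.{u} R) (c' : (A × B) →ₗ[R] Y') (i' : X' →ₗ[R] Y') (q' : Y' →ₗ[R] Z'),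
      IsSES (t.prod (b ∘ₗ q)) c' ∧ IsSES i' q' := by
  set c := t.prod (b ∘ₗ q) with hc
  have hinj : Function.Injective c := by
    rw [injective_iff_map_eq_zero]
    intro y hy
    obtain ⟨h1, h2⟩ := Prod.mk_eq_zero.1 hy
    obtain ⟨x, rfl⟩ := (hs.exact y).1 ((map_eq_zero_iff b hb.inj).1 h2)
    change t (i x) = 0 at h1
    rw [ht, map_eq_zero_iff a ha.inj] at h1
    rw [h1, map_zero]
  have hse := IsSES.mkQ hinj
  set c' := (LinearMap.range c).mkQ
  obtain ⟨q', hq'⟩ := hse.exists_desc (b' ∘ₗ LinearMap.snd R A B) (fun y => hb.comp_apply _)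
  obtain ⟨i', hi'⟩ := ha.exists_desc (c' ∘ₗ LinearMap.inl R A B) (fun x => by
    refine (hse.exact _).2 ⟨i x, ?_⟩
    change (t (i x), b (q (i x))) = (a x, 0)
    rw [ht, hs.comp_apply, map_zero])
  refine ⟨ModuleCat.of R _, c', i', q', hse, ?_, fun y' => ⟨?_, ?_⟩, fun z => ?_⟩
  · rw [injective_iff_map_eq_zero]
    intro x' hx'
    obtain ⟨u, rfl⟩ := ha.surj x'
    rw [hi'] at hx'
    obtain ⟨y, hy⟩ := (hse.exact _).1 hx'
    obtain ⟨h1, h2⟩ := Prod.mk.inj hy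
    obtain ⟨x, rfl⟩ := (hs.exact y).1 ((map_eq_zero_iff b hb.inj).1 h2)
    change t (i x) = u at h1
    rw [← h1, ht, ha.comp_apply]
  · intro h0
    obtain ⟨⟨u, v⟩, rfl⟩ := hse.surj y'
    rw [hq'] at h0
    obtain ⟨z, rfl⟩ := (hb.exact v).1 h0
    obtain ⟨y, rfl⟩ := hs.surj z
    refine ⟨a' (u - t y), ?_⟩
    rw [hi', ← sub_eq_zero, LinearMap.comp_apply, ← map_sub]
    refine (hse.exact _).2 ⟨-y, ?_⟩
    rw [map_neg]
    refine Prod.ext ?_ ?_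
    · change -t y = u - t y - u
      abel
    · change -b (q y) = 0 - b (q y)
      abel
  · rintro ⟨x', rfl⟩
    obtain ⟨u, rfl⟩ := ha.surj x'
    rw [hi', LinearMap.comp_apply, hq']
    exact map_zero b'
  · obtain ⟨v, rfl⟩ := hb.surj z
    exact ⟨c' (0, v), hq' _⟩

theorem IsGCProjective.ext (hC : IsWTilting R C) {X Y Z : ModuleCat.{u} R} {i : X →ₗ[R] Y}
    {q : Y →ₗ[R] Z} (hs : IsSES i q) (hX : IsGCProjective R C X) (hZ : IsGCProjective R C Z) :
    IsGCProjective R C Y := by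
  -- The coinductive class consists of all extensions of one `G_C`-projective by another; the
  -- horseshoe construction exhibits the cosyzygy as such an extension.
  refine IsGCProjective.coinduction (fun Y => ∃ (X Z : ModuleCat.{u} R) (i : X →ₗ[R] Y)
    (q : Y →ₗ[R] Z), IsSES i q ∧ IsGCProjective R C X ∧ IsGCProjective R C Z) ?_ ?_
    ⟨X, Z, i, q, hs, hX, hZ⟩
  · rintro Y ⟨X, Z, i, q, hs, hX, hZ⟩
    exact .ext hs hX.extVanishing hZ.extVanishing
  · rintro Y ⟨X, Z, i, q, hs, hX, hZ⟩
    obtain ⟨A, X', a, a', hA, hX', ha⟩ := hX.exists_cosyzygy hC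
    obtain ⟨B, Z', b, b', hB, hZ', hb⟩ := hZ.exists_cosyzygy hC
    obtain ⟨t, ht⟩ := hZ.extVanishing.extendsAlong hs A hA a
    obtain ⟨Y', c', i', q', hc, hs'⟩ := hs.horseshoe ha hb ht
    exact ⟨ModuleCat.of R (A × B), Y', _, c', hA.prod hB, ⟨X', Z', i', q', hs', hX', hZ'⟩, hc⟩

/-- The third isomorphism theorem for `X ⊆ Y ⊆ A`: it replaces the cokernel of `Y` in `A` by that of
`X`, which is an extension of `Y'` by `Z`. -/
theorem IsSES.exists_coker_comp {X Y Z A Y' : Type u} [AddCommGroup X] [Module R X]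
    [AddCommGroup Y] [Module R Y] [AddCommGroup Z] [Module R Z] [AddCommGroup A] [Module R A]
    [AddCommGroup Y'] [Module R Y'] {i : X →ₗ[R] Y} {q : Y →ₗ[R] Z} (hs : IsSES i q)
    {a : Y →ₗ[R] A} {a' : A →ₗ[R] Y'} (ha : IsSES a a') :
    ∃ (N : ModuleCat.{u} R) (c : A →ₗ[R] N) (i' : Z →ₗ[R] N) (q' : N →ₗ[R] Y'),
      IsSES (a ∘ₗ i) c ∧ IsSES i' q' := by
  have hse := IsSES.mkQ (i := a ∘ₗ i) (ha.inj.comp hs.inj)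
  set c := (LinearMap.range (a ∘ₗ i)).mkQ
  obtain ⟨q', hq'⟩ := hse.exists_desc a' (fun x => ha.comp_apply _)
  obtain ⟨i', hi'⟩ := hs.exists_desc (c ∘ₗ a) (fun x => hse.comp_apply x)
  refine ⟨ModuleCat.of R _, c, i', q', hse, ?_, fun n => ⟨?_, ?_⟩, fun y => ?_⟩
  · rw [injective_iff_map_eq_zero]
    intro z hz
    obtain ⟨y, rfl⟩ := hs.surj z
    rw [hi'] at hz
    obtain ⟨x, hx⟩ := (hse.exact _).1 hz
    rw [← ha.inj hx, hs.comp_apply]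
  · intro h0
    obtain ⟨u, rfl⟩ := hse.surj n
    rw [hq'] at h0
    obtain ⟨y, rfl⟩ := (ha.exact u).1 h0
    exact ⟨q y, hi' y⟩
  · rintro ⟨z, rfl⟩
    obtain ⟨y, rfl⟩ := hs.surj z
    rw [hi', LinearMap.comp_apply, hq', ha.comp_apply]
  · obtain ⟨u, rfl⟩ := ha.surj y
    exact ⟨c u, hq' u⟩

theorem IsGCProjective.ker (hC : IsWTilting R C) {X Y Z : ModuleCat.{u} R} {i : X →ₗ[R] Y}
    {q : Y →ₗ[R] Z} (hs : IsSES i q) (hY : IsGCProjective R C Y) (hZ : IsGCProjective R C Z) :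
    IsGCProjective R C X := by
  obtain ⟨A, Y', a, a', hA, hY', ha⟩ := hY.exists_cosyzygy hC
  obtain ⟨N, c, i', q', hc, hs'⟩ := hs.exists_coker_comp ha
  exact .of_cosyzygy hC hc hA (.ext hC hs' hZ hY')

theorem IsGCProjective.finsupp (hC : IsWTilting R C) {M : ModuleCat.{u} R}
    (hM : IsGCProjective R C M) (I : Type u) : IsGCProjective R C (ModuleCat.of R (I →₀ M)) := by
  refine IsGCProjective.coinduction (fun Y => ∃ (X : ModuleCat.{u} R),
    Y = ModuleCat.of R (I →₀ X) ∧ IsGCProjective R C X) ?_ ?_ ⟨M, rfl, hM⟩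
  · rintro _ ⟨X, rfl, hX⟩
    exact hX.extVanishing.finsupp I
  · rintro _ ⟨X, rfl, hX⟩
    obtain ⟨A, N, j, q, hA, hN, hs⟩ := hX.exists_cosyzygy hC
    exact ⟨ModuleCat.of R (I →₀ A), ModuleCat.of R (I →₀ N), _, _, hA.finsupp I, ⟨N, rfl, hN⟩,
      isSES_mapRange hs I⟩

/-- The coresolution in the definition of w-tilting is precisely the right half of a complete
resolution of `R`; the left half is free because `R` is projective. -/
theorem IsWTilting.isGCProjective_self (hC : IsWTilting R C) :
    IsGCProjective R C (ModuleCat.of R R) := by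
  obtain ⟨-, A, e, a, hA, h0, he, ha⟩ := hC
  refine isGCProjective_iff.2 ⟨.of_projective (inferInstanceAs (Module.Projective R R)),
    .of_complex A a e hA ha he ?_ ?_⟩
  · rw [injective_iff_map_eq_zero]
    intro x hx
    obtain ⟨y, rfl⟩ := (h0.1 x).1 hx
    rfl
  · intro F hF h
    obtain ⟨k, hk⟩ := (h0.2 F hF h).1 (by ext; simp)
    exact ⟨k, LinearMap.congr_fun hk⟩

theorem isSES_inl_snd (X Y : Type u) [AddCommGroup X] [Module R X] [AddCommGroup Y] [Module R Y] :
    IsSES (LinearMap.inl R X Y) (LinearMap.snd R X Y) :=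
  ⟨LinearMap.inl_injective, .inl_snd, LinearMap.snd_surjective⟩

theorem IsWTilting.exists_complement (hC : IsWTilting R C) (P : ModuleCat.{u} R)
    (hP : Module.Projective R P) : ∃ Q : ModuleCat.{u} R, Module.Projective R Q ∧
      IsGCProjective R C (ModuleCat.of R (P × Q)) := by
  have : InAdd R R P := by
    obtain ⟨s, hs⟩ := hP.out
    exact inAdd_iff.2 ⟨P, s, _, hs⟩
  obtain ⟨I, Q, ⟨e⟩⟩ := this
  refine ⟨Q, .of_split (e.toLinearMap ∘ₗ LinearMap.inr R P Q)
    (LinearMap.snd R P Q ∘ₗ e.symm.toLinearMap) (LinearMap.ext fun x => by simp), ?_⟩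
  -- Transport along `P × Q ≅ R^(I)`, using the kernel property with zero third term; the zero
  -- module is handled by coinduction on the class of zero modules.
  refine .ker hC (Y := ModuleCat.of R (I →₀ R)) (isSES_equiv e)
    (hC.isGCProjective_self.finsupp hC I) (Z := ModuleCat.of R PUnit) ?_
  refine .coinduction (fun X => Subsingleton X)
    (fun X (hX : Subsingleton X) => .of_projective (.of_split (0 : X →ₗ[R] R) 0
      (LinearMap.ext fun x => Subsingleton.elim _ _)))
    (fun X (hX : Subsingleton X) => ⟨X, X, 0, 0, inAdd_iff.2 ⟨PUnit, 0, 0, fun x => Subsingleton.elim _ _⟩, hX,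
      fun _ _ _ => Subsingleton.elim _ _, fun y => ⟨fun _ => ⟨0, Subsingleton.elim _ _⟩,
      fun _ => rfl⟩, fun y => ⟨0, Subsingleton.elim _ _⟩⟩)
    (inferInstanceAs (Subsingleton PUnit))

/-- Closure under direct summands is not available yet, so the coinduction runs over modules `X`
that become `G_C`-projective after adding some projective `Q`. -/
theorem IsGCProjective.of_projective (hC : IsWTilting R C) {P : ModuleCat.{u} R}
    (hP : Module.Projective R P) : IsGCProjective R C P := by
  refine IsGCProjective.coinduction (fun X => ∃ Q : ModuleCat.{u} R, Module.Projective R Q ∧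
    IsGCProjective R C (ModuleCat.of R (X × Q))) ?_ ?_ (hC.exists_complement P hP)
  · rintro X ⟨Q, -, hX⟩
    exact hX.extVanishing.of_retract (s := LinearMap.inl R X Q) (r := LinearMap.fst R X Q)
      fun _ => rfl
  · rintro X ⟨Q, hQ, hX⟩
    obtain ⟨A, N, a, a', hA, hN, ha⟩ := hX.exists_cosyzygy hC
    -- Embedding `X` in `A` through `X × Q` gives a cokernel `X'` that is an extension of `N` by
    -- `Q`. Adding `Q'`, chosen so that `Q × Q'` is `G_C`-projective, makes `X' × Q'` an extension
    -- of two `G_C`-projectives.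
    obtain ⟨X', c, i', q', hc, hs'⟩ := (isSES_inl_snd (R := R) X Q).exists_coker_comp ha
    obtain ⟨Q', hQ', hQQ'⟩ := hC.exists_complement Q hQ
    refine ⟨A, X', _, c, hA, ⟨Q', hQ', ?_⟩, hc⟩
    refine .ext hC (X := ModuleCat.of R (Q × Q')) (Y := ModuleCat.of R (X' × Q')) (Z := N)
      (i := i'.prodMap LinearMap.id) (q := q' ∘ₗ LinearMap.fst R X' Q')
      ⟨hs'.inj.prodMap Function.injective_id, ?_, hs'.surj.comp LinearMap.fst_surjective⟩ hQQ' hN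
    rintro ⟨x, y⟩
    refine (hs'.exact x).trans ⟨?_, ?_⟩
    · rintro ⟨z, rfl⟩
      exact ⟨(z, y), rfl⟩
    · rintro ⟨⟨z, w⟩, h⟩
      exact ⟨z, congrArg Prod.fst h⟩

theorem IsWTilting.isResolving (hC : IsWTilting R C) : IsResolving (IsGCProjective R C) :=
  ⟨fun _ hP => .of_projective hC hP, fun hs hX hZ => .ext hC hs hX hZ,
    fun hs hY hZ => .ker hC hs hY hZ⟩

end RelativeGorensteinClosure

/-! ### Components, structure map and cokernel of a `T(R)`-module. -/

section TriangularComponents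

variable {R : Type u} [Ring R]

/-- The lower triangular matrix with rows `(a, 0)` and `(u, b)`. -/
def T2.mk (a u b : R) : T2 R := ⟨!![a, 0; u, b], by change (!![a, 0; u, b] : Matrix _ _ R) 0 1 = 0; simp⟩

theorem T2.ext' {s t : T2 R} (h1 : s.1 0 0 = t.1 0 0) (h2 : s.1 1 0 = t.1 1 0)
    (h3 : s.1 1 1 = t.1 1 1) : s = t := by
  have hs : s.1 0 1 = 0 := s.2
  have ht : t.1 0 1 = 0 := t.2
  apply Subtype.ext
  ext i j
  fin_cases i <;> fin_cases j <;> simp_all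

theorem T2.eq_mk (t : T2 R) : t = T2.mk (t.1 0 0) (t.1 1 0) (t.1 1 1) :=
  T2.ext' rfl rfl rfl

theorem T2.mk_mul (a u b a' u' b' : R) :
    T2.mk a u b * T2.mk a' u' b' = T2.mk (a * a') (u * a' + b * u') (b * b') := by
  apply T2.ext' <;> simp [T2.mk]

theorem T2.mk_add (a u b a' u' b' : R) :
    T2.mk a u b + T2.mk a' u' b' = T2.mk (a + a') (u + u') (b + b') := by
  apply T2.ext' <;> simp [T2.mk]

theorem T2.mk_one : T2.mk (1 : R) 0 1 = 1 := by
  apply T2.ext' <;> simp [T2.mk]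

theorem T2.mk_zero : T2.mk (0 : R) 0 0 = 0 := by
  apply T2.ext' <;> simp [T2.mk]

variable (R)
variable (M : Type u) [AddCommGroup M] [Module (T2 R) M]

/-- The additive group of elements of the first component of a `T(R)`-module. -/
def fstSubgroup : AddSubgroup M where
  carrier := {m | T2.mk (1 : R) 0 0 • m = m}
  add_mem' {a b} ha hb := by
    change _ = _ at ha hb
    change T2.mk (1 : R) 0 0 • (a + b) = a + b
    rw [smul_add, ha, hb]
  zero_mem' := smul_zero _
  neg_mem' {a} ha := by
    change _ = _ at ha
    change T2.mk (1 : R) 0 0 • (-a) = -a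
    rw [smul_neg, ha]

/-- The additive group of elements of the second component of a `T(R)`-module. -/
def sndSubgroup : AddSubgroup M where
  carrier := {m | T2.mk (0 : R) 0 1 • m = m}
  add_mem' {a b} ha hb := by
    change _ = _ at ha hb
    change T2.mk (0 : R) 0 1 • (a + b) = a + b
    rw [smul_add, ha, hb]
  zero_mem' := smul_zero _
  neg_mem' {a} ha := by
    change _ = _ at ha
    change T2.mk (0 : R) 0 1 • (-a) = -a
    rw [smul_neg, ha]

/-- The first component of a `T(R)`-module. -/
abbrev FstComp : Type u := fstSubgroup R M

/-- The second component of a `T(R)`-module. -/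
abbrev SndComp : Type u := sndSubgroup R M

variable {R M}

theorem FstComp.idem_smul (x : FstComp R M) : T2.mk (1 : R) 0 0 • x.1 = x.1 := x.2

theorem SndComp.idem_smul (x : SndComp R M) : T2.mk (0 : R) 0 1 • x.1 = x.1 := x.2

instance : Module R (FstComp R M) where
  smul r x := ⟨T2.mk r 0 0 • x.1, by
    change T2.mk (1 : R) 0 0 • _ = _
    rw [smul_smul, T2.mk_mul]; simp⟩
  one_smul x := Subtype.ext x.idem_smul
  mul_smul r s x := Subtype.ext <| by
    change T2.mk (r * s) 0 0 • x.1 = T2.mk r 0 0 • T2.mk s 0 0 • x.1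
    rw [smul_smul, T2.mk_mul]; simp
  smul_zero r := Subtype.ext (smul_zero _)
  smul_add r x y := Subtype.ext (smul_add _ _ _)
  add_smul r s x := Subtype.ext <| by
    change T2.mk (r + s) 0 0 • x.1 = T2.mk r 0 0 • x.1 + T2.mk s 0 0 • x.1
    rw [← add_smul, T2.mk_add]; simp
  zero_smul x := Subtype.ext <| by
    change T2.mk (0 : R) 0 0 • x.1 = 0
    rw [T2.mk_zero, zero_smul]

instance : Module R (SndComp R M) where
  smul r x := ⟨T2.mk 0 0 r • x.1, by
    change T2.mk (0 : R) 0 1 • _ = _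
    rw [smul_smul, T2.mk_mul]; simp⟩
  one_smul x := Subtype.ext x.idem_smul
  mul_smul r s x := Subtype.ext <| by
    change T2.mk 0 0 (r * s) • x.1 = T2.mk 0 0 r • T2.mk 0 0 s • x.1
    rw [smul_smul, T2.mk_mul]; simp
  smul_zero r := Subtype.ext (smul_zero _)
  smul_add r x y := Subtype.ext (smul_add _ _ _)
  add_smul r s x := Subtype.ext <| by
    change T2.mk 0 0 (r + s) • x.1 = T2.mk 0 0 r • x.1 + T2.mk 0 0 s • x.1
    rw [← add_smul, T2.mk_add]; simp
  zero_smul x := Subtype.ext <| by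
    change T2.mk (0 : R) 0 0 • x.1 = 0
    rw [T2.mk_zero, zero_smul]

theorem FstComp.coe_smul (r : R) (x : FstComp R M) : (r • x).1 = T2.mk r 0 0 • x.1 := rfl

theorem SndComp.coe_smul (r : R) (x : SndComp R M) : (r • x).1 = T2.mk 0 0 r • x.1 := rfl

theorem SndComp.coe_add (x y : SndComp R M) : (x + y).1 = x.1 + y.1 := rfl

variable (R M)

/-- The structure map of a `T(R)`-module. -/
def strMap : FstComp R M →ₗ[R] SndComp R M where
  toFun x := ⟨T2.mk (0 : R) 1 0 • x.1, by
    change T2.mk (0 : R) 0 1 • _ = _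
    rw [smul_smul, T2.mk_mul]; simp⟩
  map_add' x y := Subtype.ext (smul_add _ _ _)
  map_smul' r x := Subtype.ext <| by
    change T2.mk (0 : R) 1 0 • T2.mk r 0 0 • x.1 = T2.mk 0 0 r • T2.mk (0 : R) 1 0 • x.1
    rw [smul_smul, smul_smul, T2.mk_mul, T2.mk_mul]; simp

/-- The cokernel of the structure map of a `T(R)`-module. -/
abbrev StrCoker : Type u := SndComp R M ⧸ LinearMap.range (strMap R M)

variable {M}

/-- The first component of an element. -/
def toFst (m : M) : FstComp R M := ⟨T2.mk (1 : R) 0 0 • m, by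
  change T2.mk (1 : R) 0 0 • _ = _
  rw [smul_smul, T2.mk_mul]; simp⟩

/-- The second component of an element. -/
def toSnd (m : M) : SndComp R M := ⟨T2.mk (0 : R) 0 1 • m, by
  change T2.mk (0 : R) 0 1 • _ = _
  rw [smul_smul, T2.mk_mul]; simp⟩

variable {R}

theorem strMap_coe (x : FstComp R M) : (strMap R M x).1 = T2.mk (0 : R) 1 0 • x.1 := rfl

theorem toFst_add_toSnd (m : M) : (toFst R m).1 + (toSnd R m).1 = m := by
  change T2.mk (1 : R) 0 0 • m + T2.mk (0 : R) 0 1 • m = m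
  rw [← add_smul, T2.mk_add, add_zero, add_zero, zero_add, T2.mk_one, one_smul]

theorem toFst_add (m n : M) : toFst R (m + n) = toFst R m + toFst R n :=
  Subtype.ext (smul_add _ _ _)

theorem toSnd_add (m n : M) : toSnd R (m + n) = toSnd R m + toSnd R n :=
  Subtype.ext (smul_add _ _ _)

theorem toFst_smul (t : T2 R) (m : M) : toFst R (t • m) = t.1 0 0 • toFst R m := by
  apply Subtype.ext
  rw [FstComp.coe_smul]
  change T2.mk (1 : R) 0 0 • t • m = T2.mk (t.1 0 0) 0 0 • T2.mk (1 : R) 0 0 • m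
  conv_lhs => rw [T2.eq_mk t]
  rw [smul_smul, smul_smul, T2.mk_mul, T2.mk_mul]
  simp

theorem toSnd_smul (t : T2 R) (m : M) :
    toSnd R (t • m) = strMap R M (t.1 1 0 • toFst R m) + t.1 1 1 • toSnd R m := by
  apply Subtype.ext
  rw [SndComp.coe_add, SndComp.coe_smul, strMap_coe, FstComp.coe_smul]
  change T2.mk (0 : R) 0 1 • t • m = T2.mk (0 : R) 1 0 • T2.mk (t.1 1 0) 0 0 •
    T2.mk (1 : R) 0 0 • m + T2.mk 0 0 (t.1 1 1) • T2.mk (0 : R) 0 1 • m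
  conv_lhs => rw [T2.eq_mk t]
  simp only [smul_smul, T2.mk_mul, ← add_smul, T2.mk_add]
  simp

theorem toFst_coe (x : FstComp R M) : toFst R x.1 = x := Subtype.ext x.idem_smul

theorem toSnd_coe (x : SndComp R M) : toSnd R x.1 = x := Subtype.ext x.idem_smul

theorem comp_ext {m n : M} (h1 : toFst R m = toFst R n) (h2 : toSnd R m = toSnd R n) : m = n := by
  rw [← toFst_add_toSnd (R := R) m, ← toFst_add_toSnd (R := R) n, h1, h2]

section Functoriality

variable {N L : Type u} [AddCommGroup N] [Module (T2 R) N] [AddCommGroup L] [Module (T2 R) L]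

/-- The map on first components induced by a `T(R)`-linear map. -/
def FstComp.map (f : M →ₗ[T2 R] N) : FstComp R M →ₗ[R] FstComp R N where
  toFun x := ⟨f x.1, by
    change T2.mk (1 : R) 0 0 • _ = _
    rw [← map_smul]; exact congrArg f x.2⟩
  map_add' x y := Subtype.ext (map_add f _ _)
  map_smul' r x := Subtype.ext (map_smul f _ _)

/-- The map on second components induced by a `T(R)`-linear map. -/
def SndComp.map (f : M →ₗ[T2 R] N) : SndComp R M →ₗ[R] SndComp R N where
  toFun x := ⟨f x.1, by
    change T2.mk (0 : R) 0 1 • _ = _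
    rw [← map_smul]; exact congrArg f x.2⟩
  map_add' x y := Subtype.ext (map_add f _ _)
  map_smul' r x := Subtype.ext (map_smul f _ _)

theorem toFst_map (f : M →ₗ[T2 R] N) (m : M) : toFst R (f m) = FstComp.map f (toFst R m) :=
  Subtype.ext (map_smul f _ _).symm

theorem toSnd_map (f : M →ₗ[T2 R] N) (m : M) : toSnd R (f m) = SndComp.map f (toSnd R m) :=
  Subtype.ext (map_smul f _ _).symm

theorem strMap_map (f : M →ₗ[T2 R] N) (x : FstComp R M) :
    strMap R N (FstComp.map f x) = SndComp.map f (strMap R M x) :=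
  Subtype.ext (map_smul f _ _).symm

/-- The map on cokernels of structure maps induced by a `T(R)`-linear map. -/
def StrCoker.map (f : M →ₗ[T2 R] N) : StrCoker R M →ₗ[R] StrCoker R N :=
  Submodule.mapQ _ _ (SndComp.map f) (by
    rintro _ ⟨x, rfl⟩
    exact ⟨FstComp.map f x, strMap_map f x⟩)

theorem StrCoker.map_mkQ (f : M →ₗ[T2 R] N) (x : SndComp R M) :
    StrCoker.map f ((LinearMap.range (strMap R M)).mkQ x) =
      (LinearMap.range (strMap R N)).mkQ (SndComp.map f x) := rfl

theorem isSES_strMap (h : Function.Injective (strMap R M)) :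
    IsSES (strMap R M) (LinearMap.range (strMap R M)).mkQ := .mkQ h

variable {i : M →ₗ[T2 R] N} {q : N →ₗ[T2 R] L}

theorem IsSES.fstComp (hs : IsSES i q) : IsSES (FstComp.map i) (FstComp.map q) := by
  refine ⟨fun x y h => Subtype.ext (hs.inj (congrArg Subtype.val h)), fun y => ⟨fun h => ?_, ?_⟩,
    fun z => ?_⟩
  · obtain ⟨m, hm⟩ := (hs.exact y.1).1 (congrArg Subtype.val h)
    exact ⟨toFst R m, by rw [← toFst_map, hm, toFst_coe]⟩
  · rintro ⟨x, rfl⟩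
    exact Subtype.ext (hs.comp_apply x.1)
  · obtain ⟨y, hy⟩ := hs.surj z.1
    exact ⟨toFst R y, by rw [← toFst_map, hy, toFst_coe]⟩

theorem IsSES.sndComp (hs : IsSES i q) : IsSES (SndComp.map i) (SndComp.map q) := by
  refine ⟨fun x y h => Subtype.ext (hs.inj (congrArg Subtype.val h)), fun y => ⟨fun h => ?_, ?_⟩,
    fun z => ?_⟩
  · obtain ⟨m, hm⟩ := (hs.exact y.1).1 (congrArg Subtype.val h)
    exact ⟨toSnd R m, by rw [← toSnd_map, hm, toSnd_coe]⟩
  · rintro ⟨x, rfl⟩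
    exact Subtype.ext (hs.comp_apply x.1)
  · obtain ⟨y, hy⟩ := hs.surj z.1
    exact ⟨toSnd R y, by rw [← toSnd_map, hy, toSnd_coe]⟩

theorem strMap_injective_of_injective (hi : Function.Injective i)
    (hN : Function.Injective (strMap R N)) : Function.Injective (strMap R M) := by
  intro x y h
  refine Subtype.ext (hi ?_)
  have : FstComp.map i x = FstComp.map i y := hN (by rw [strMap_map, strMap_map, h])
  exact congrArg Subtype.val this

theorem IsSES.strMap_injective (hs : IsSES i q) (hM : Function.Injective (strMap R M))
    (hL : Function.Injective (strMap R L)) : Function.Injective (strMap R N) := by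
  rw [injective_iff_map_eq_zero]
  intro y hy
  obtain ⟨x, rfl⟩ := (hs.fstComp.exact y).1
    (hL (by rw [strMap_map, hy, map_zero, map_zero]))
  have h0 : strMap R M x = 0 := hs.sndComp.inj (by rw [← strMap_map, hy, map_zero])
  rw [(map_eq_zero_iff _ hM).1 h0, map_zero]

theorem strCoker_mkQ_eq_zero {y : SndComp R M} :
    (LinearMap.range (strMap R M)).mkQ y = 0 ↔ ∃ x, strMap R M x = y := by
  simp

/-- Snake lemma: the connecting map into the cokernel for `M` starts at the kernel of the structure
map of `L`, which vanishes here. -/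
theorem IsSES.strCoker (hs : IsSES i q) (hL : Function.Injective (strMap R L)) :
    IsSES (StrCoker.map i) (StrCoker.map q) := by
  refine ⟨?_, fun n => ⟨fun h => ?_, ?_⟩, fun z => ?_⟩
  · rw [injective_iff_map_eq_zero]
    intro m hm
    obtain ⟨x, rfl⟩ := Submodule.mkQ_surjective _ m
    rw [StrCoker.map_mkQ, strCoker_mkQ_eq_zero] at hm
    obtain ⟨y, hy⟩ := hm
    obtain ⟨w, rfl⟩ := (hs.fstComp.exact y).1
      (hL (by rw [strMap_map, hy, hs.sndComp.comp_apply, map_zero]))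
    refine strCoker_mkQ_eq_zero.2 ⟨w, hs.sndComp.inj ?_⟩
    rw [← strMap_map, hy]
  · obtain ⟨y, rfl⟩ := Submodule.mkQ_surjective _ n
    rw [StrCoker.map_mkQ, strCoker_mkQ_eq_zero] at h
    obtain ⟨z, hz⟩ := h
    obtain ⟨w, rfl⟩ := hs.fstComp.surj z
    obtain ⟨x, hx⟩ := (hs.sndComp.exact (y - strMap R N w)).1
      (by rw [map_sub, ← hz, strMap_map, sub_self])
    refine ⟨(LinearMap.range (strMap R M)).mkQ x, ?_⟩
    rw [StrCoker.map_mkQ, hx, ← sub_eq_zero, ← map_sub]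
    exact strCoker_mkQ_eq_zero.2 ⟨-w, by rw [map_neg]; abel⟩
  · rintro ⟨m, rfl⟩
    obtain ⟨x, rfl⟩ := Submodule.mkQ_surjective _ m
    rw [StrCoker.map_mkQ, StrCoker.map_mkQ, hs.sndComp.comp_apply, map_zero]
  · obtain ⟨y, rfl⟩ := Submodule.mkQ_surjective _ z
    obtain ⟨x, rfl⟩ := hs.sndComp.surj y
    exact ⟨(LinearMap.range (strMap R N)).mkQ x, rfl⟩

/-- Snake lemma again: the kernel for `L` lies between the kernel for `N`, which is zero, and the
kernel of the map on cokernels, also zero. -/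
theorem IsSES.strMap_injective_right (hs : IsSES i q)
    (hi : Function.Injective (StrCoker.map i)) (hN : Function.Injective (strMap R N)) :
    Function.Injective (strMap R L) := by
  rw [injective_iff_map_eq_zero]
  intro z hz
  obtain ⟨y, rfl⟩ := hs.fstComp.surj z
  rw [strMap_map] at hz
  obtain ⟨x, hx⟩ := (hs.sndComp.exact _).1 hz
  obtain ⟨w, rfl⟩ := strCoker_mkQ_eq_zero.1 (hi (a₁ := (LinearMap.range (strMap R M)).mkQ x)
    (a₂ := 0) (by rw [StrCoker.map_mkQ, hx, map_zero]; exact strCoker_mkQ_eq_zero.2 ⟨y, rfl⟩))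
  rw [← strMap_map] at hx
  rw [← hN hx, hs.fstComp.comp_apply]

end Functoriality

/-! ### Triples and linear maps into them. -/

section TriMod

variable {X Y : Type u} [AddCommGroup X] [Module R X] [AddCommGroup Y] [Module R Y]
  {φ : X →ₗ[R] Y}

/-- A `T(R)`-linear map to a triple, given by its components. -/
def TriMod.lift (f : FstComp R M →ₗ[R] X) (g : SndComp R M →ₗ[R] Y)
    (h : ∀ x, g (strMap R M x) = φ (f x)) : M →ₗ[T2 R] TriMod φ where
  toFun m := ((f (toFst R m), g (toSnd R m)) : X × Y)
  map_add' m n := by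
    refine Prod.ext ?_ ?_
    · exact (congrArg f (toFst_add m n)).trans (map_add f _ _)
    · exact (congrArg g (toSnd_add m n)).trans (map_add g _ _)
  map_smul' t m := by
    refine Prod.ext ?_ ?_
    · exact (congrArg f (toFst_smul t m)).trans (map_smul f _ _)
    · change g (toSnd R (t • m)) = φ (t.1 1 0 • f (toFst R m)) + t.1 1 1 • g (toSnd R m)
      rw [toSnd_smul]
      rw [map_add, h, map_smul f, map_smul g]

variable (φ) in
/-- The first component of a triple. -/
def TriMod.fstEquiv : FstComp R (TriMod φ) ≃ₗ[R] X where
  toFun z := z.1.1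
  map_add' _ _ := rfl
  map_smul' r z := rfl
  invFun x := ⟨((x, 0) : X × Y), Prod.ext (one_smul R x) (by
    change φ ((0 : R) • x) + (0 : R) • (0 : Y) = 0
    simp)⟩
  left_inv z := Subtype.ext (Prod.ext rfl (by
    have h : φ ((0 : R) • z.1.1) + (0 : R) • z.1.2 = z.1.2 := congrArg Prod.snd z.2
    change 0 = z.1.2
    rw [← h]
    simp))
  right_inv x := rfl

variable (φ) in
/-- The second component of a triple. -/
def TriMod.sndEquiv : SndComp R (TriMod φ) ≃ₗ[R] Y where
  toFun z := z.1.2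
  map_add' _ _ := rfl
  map_smul' r z := by
    change φ ((0 : R) • z.1.1) + r • z.1.2 = r • z.1.2
    simp
  invFun y := ⟨((0, y) : X × Y), Prod.ext (smul_zero _) (by
    change φ ((0 : R) • (0 : X)) + (1 : R) • y = y
    simp)⟩
  left_inv z := Subtype.ext (Prod.ext (by
    have h : (0 : R) • z.1.1 = z.1.1 := congrArg Prod.fst z.2
    change 0 = z.1.1
    rw [← h]
    simp) rfl)
  right_inv y := rfl

theorem TriMod.sndEquiv_strMap (x : FstComp R (TriMod φ)) :
    TriMod.sndEquiv φ (strMap R (TriMod φ) x) = φ (TriMod.fstEquiv φ x) := by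
  change φ ((1 : R) • x.1.1) + (0 : R) • x.1.2 = φ x.1.1
  simp

theorem TriMod.strMap_injective (h : Function.Injective φ) :
    Function.Injective (strMap R (TriMod φ)) := by
  intro x y hxy
  apply (TriMod.fstEquiv φ).injective
  apply h
  rw [← TriMod.sndEquiv_strMap, ← TriMod.sndEquiv_strMap, hxy]

theorem TriMod.injective_of_strMap (h : Function.Injective (strMap R (TriMod φ))) :
    Function.Injective φ := by
  intro x y hxy
  apply (TriMod.fstEquiv φ).symm.injective
  apply h
  apply (TriMod.sndEquiv φ).injective
  simpa [TriMod.sndEquiv_strMap] using hxy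

theorem TriMod.nonempty_strCokerEquiv {Z : Type u} [AddCommGroup Z] [Module R Z]
    {ψ : Y →ₗ[R] Z} (hψ : Function.Surjective ψ) (h : Function.Exact φ ψ) :
    Nonempty (StrCoker R (TriMod φ) ≃ₗ[R] Z) := by
  have hsurj : Function.Surjective (ψ ∘ₗ (TriMod.sndEquiv φ).toLinearMap) :=
    hψ.comp (TriMod.sndEquiv φ).surjective
  refine ⟨(Submodule.quotEquivOfEq _ _ ?_).trans (LinearMap.quotKerEquivOfSurjective _ hsurj)⟩
  ext y
  rw [LinearMap.mem_ker, LinearMap.mem_range, LinearMap.comp_apply]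
  refine Iff.trans ?_ (h _).symm
  constructor
  · rintro ⟨x, rfl⟩
    exact ⟨_, (TriMod.sndEquiv_strMap x).symm⟩
  · rintro ⟨x, hx⟩
    refine ⟨(TriMod.fstEquiv φ).symm x, (TriMod.sndEquiv φ).injective ?_⟩
    rw [TriMod.sndEquiv_strMap, LinearEquiv.apply_symm_apply]
    exact hx

variable {X' Y' : Type u} [AddCommGroup X'] [Module R X'] [AddCommGroup Y'] [Module R Y']
  {φ' : X' →ₗ[R] Y'}

/-- The map of triples induced by a commutative square. -/
def TriMod.map (f : X →ₗ[R] X') (g : Y →ₗ[R] Y') (h : ∀ x, g (φ x) = φ' (f x)) :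
    TriMod φ →ₗ[T2 R] TriMod φ' where
  toFun z := ((f z.1, g z.2) : X' × Y')
  map_add' z w := Prod.ext (map_add f _ _) (map_add g _ _)
  map_smul' t z := by
    refine Prod.ext (map_smul f _ _) ?_
    change g (φ (t.1 1 0 • z.1) + t.1 1 1 • z.2) = φ' (t.1 1 0 • f z.1) + t.1 1 1 • g z.2
    rw [map_add, h, map_smul f, map_smul g]

/-- `T(R)`-linear maps to `p(X, Y)` correspond to pairs of maps. -/
def pMod.lift (g : SndComp R M →ₗ[R] X) (k : StrCoker R M →ₗ[R] Y) : M →ₗ[T2 R] pMod R X Y :=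
  TriMod.lift (g ∘ₗ strMap R M) (g.prod (k ∘ₗ (LinearMap.range (strMap R M)).mkQ)) fun x => by
    refine Prod.ext rfl ?_
    change k ((LinearMap.range (strMap R M)).mkQ (strMap R M x)) = 0
    rw [strCoker_mkQ_eq_zero.2 ⟨x, rfl⟩, map_zero]

theorem pMod.lift_apply (g : SndComp R M →ₗ[R] X) (k : StrCoker R M →ₗ[R] Y) (m : M) :
    pMod.lift g k m = ((g (strMap R M (toFst R m)), (g (toSnd R m),
      k ((LinearMap.range (strMap R M)).mkQ (toSnd R m)))) : X × X × Y) := rfl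

/-- Since the structure map of `p(X, Y)` is the inclusion of `X`, compatibility forces the first
component to be `g ∘ φ` and makes the `Y`-part of the second component vanish on the image of `φ`,
so it descends to the cokernel. -/
theorem pMod.exists_eq_lift (f : M →ₗ[T2 R] pMod R X Y) :
    ∃ (g : SndComp R M →ₗ[R] X) (k : StrCoker R M →ₗ[R] Y), f = pMod.lift g k := by
  let s : SndComp R M →ₗ[R] X × Y :=
    (TriMod.sndEquiv (LinearMap.inl R X Y)).toLinearMap ∘ₗ SndComp.map f
  have hs : ∀ x, s (strMap R M x) =
      (TriMod.fstEquiv (LinearMap.inl R X Y) (FstComp.map f x), 0) := fun x => by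
    change TriMod.sndEquiv _ (SndComp.map f (strMap R M x)) = _
    rw [← strMap_map, TriMod.sndEquiv_strMap]
    rfl
  refine ⟨LinearMap.fst R X Y ∘ₗ s, Submodule.liftQ _ (LinearMap.snd R X Y ∘ₗ s) ?_, ?_⟩
  · rintro _ ⟨x, rfl⟩
    rw [LinearMap.mem_ker, LinearMap.comp_apply, hs]
    rfl
  · ext m
    rw [pMod.lift_apply]
    refine comp_ext (R := R) ?_ ?_
    · rw [toFst_map]
      apply (TriMod.fstEquiv (LinearMap.inl R X Y)).injective
      change _ = (1 : R) • (s (strMap R M (toFst R m))).1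
      rw [hs, one_smul]
    · rw [toSnd_map]
      apply (TriMod.sndEquiv (LinearMap.inl R X Y)).injective
      change s (toSnd R m) = LinearMap.inl R X Y ((0 : R) • _) + (1 : R) • s (toSnd R m)
      simp

end TriMod

end TriangularComponents

/-! ### `Add(p(C, C))` and the projective modules over `T(R)`. -/

section TriangularAdd

variable {R : Type u} [Ring R] {C : Type u} [AddCommGroup C] [Module R C]

/-- The functor `p` commutes with direct sums. -/
noncomputable def pMod.finsuppEquiv (I X Y : Type u) [AddCommGroup X] [Module R X]
    [AddCommGroup Y] [Module R Y] :
    (I →₀ pMod R X Y) ≃ₗ[T2 R] pMod R (I →₀ X) (I →₀ Y) where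
  toFun f := ((Finsupp.mapRange (fun z : pMod R X Y => z.1) rfl f,
    Finsupp.mapRange (fun z : pMod R X Y => z.2.1) rfl f,
    Finsupp.mapRange (fun z : pMod R X Y => z.2.2) rfl f) : (I →₀ X) × (I →₀ X) × (I →₀ Y))
  map_add' f g := by
    refine Prod.ext ?_ (Prod.ext ?_ ?_) <;> exact Finsupp.ext fun a => rfl
  map_smul' t f := by
    refine Prod.ext ?_ (Prod.ext ?_ ?_) <;> exact Finsupp.ext fun a => rfl
  invFun z :=
    Finsupp.mapRange (fun x : X => ((x, 0, 0) : X × X × Y)) rfl z.1 +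
    (Finsupp.mapRange (fun x : X => ((0, x, 0) : X × X × Y)) rfl z.2.1 +
      Finsupp.mapRange (fun y : Y => ((0, 0, y) : X × X × Y)) rfl z.2.2 : I →₀ X × X × Y)
  left_inv f := Finsupp.ext fun a => by
    refine Prod.ext ?_ (Prod.ext ?_ ?_)
    · change (f a).1 + (0 + 0) = (f a).1
      simp
    · change 0 + ((f a).2.1 + 0) = (f a).2.1
      simp
    · change 0 + (0 + (f a).2.2) = (f a).2.2
      simp
  right_inv z := by
    refine Prod.ext ?_ (Prod.ext ?_ ?_)
    · refine Finsupp.ext fun a => ?_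
      change z.1 a + (0 + 0) = z.1 a
      simp
    · refine Finsupp.ext fun a => ?_
      change 0 + (z.2.1 a + 0) = z.2.1 a
      simp
    · refine Finsupp.ext fun a => ?_
      change 0 + (0 + z.2.2 a) = z.2.2 a
      simp

theorem inAdd_pMod {X Y : ModuleCat.{u} R} (hX : InAdd R C X) (hY : InAdd R C Y) :
    InAdd (T2 R) (pMod R C C) (ModuleCat.of (T2 R) (pMod R X Y)) := by
  -- Passing through `X × Y` exhibits both modules as retracts of `C^(I)` with the same index set.
  obtain ⟨I, s, r, h⟩ := inAdd_iff.1 (hX.prod hY)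
  let sX := s ∘ₗ LinearMap.inl R X Y
  let sY := s ∘ₗ LinearMap.inr R X Y
  let rX := LinearMap.fst R X Y ∘ₗ r
  let rY := LinearMap.snd R X Y ∘ₗ r
  have hX : ∀ x, rX (sX x) = x := fun x => congrArg Prod.fst (h (x, 0))
  have hY : ∀ y, rY (sY y) = y := fun y => congrArg Prod.snd (h (0, y))
  refine inAdd_iff.2 ⟨I, (pMod.finsuppEquiv I C C).symm.toLinearMap ∘ₗ
    TriMod.map sX (sX.prodMap sY) (fun x => by simp),
    TriMod.map rX (rX.prodMap rY) (fun x => by simp) ∘ₗ (pMod.finsuppEquiv I C C).toLinearMap,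
    fun z => ?_⟩
  rw [LinearMap.comp_apply, LinearMap.comp_apply, LinearEquiv.coe_coe, LinearEquiv.coe_coe,
    LinearEquiv.apply_symm_apply]
  exact Prod.ext (hX z.1) (Prod.ext (hX z.2.1) (hY z.2.2))

theorem InAdd.exists_retract_pMod {F : ModuleCat.{u} (T2 R)}
    (hF : InAdd (T2 R) (pMod R C C) F) : ∃ (X : ModuleCat.{u} R) (s : F →ₗ[T2 R] pMod R X X)
      (r : pMod R X X →ₗ[T2 R] F), InAdd R C X ∧ ∀ x, r (s x) = x := by
  obtain ⟨I, s, r, h⟩ := inAdd_iff.1 hF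
  exact ⟨ModuleCat.of R (I →₀ C), (pMod.finsuppEquiv I C C).toLinearMap ∘ₗ s,
    r ∘ₗ (pMod.finsuppEquiv I C C).symm.toLinearMap, inAdd_finsupp I, fun x => by simp [h]⟩

theorem pMod.nonempty_strCokerEquiv (X Y : Type u) [AddCommGroup X] [Module R X]
    [AddCommGroup Y] [Module R Y] : Nonempty (StrCoker R (pMod R X Y) ≃ₗ[R] Y) :=
  TriMod.nonempty_strCokerEquiv LinearMap.snd_surjective .inl_snd

theorem InAdd.strMap_injective {F : ModuleCat.{u} (T2 R)}
    (hF : InAdd (T2 R) (pMod R C C) F) : Function.Injective (strMap R F) := by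
  obtain ⟨X, s, r, -, h⟩ := hF.exists_retract_pMod
  exact strMap_injective_of_injective (Function.LeftInverse.injective h)
    (TriMod.strMap_injective LinearMap.inl_injective)

theorem InAdd.sndComp {F : ModuleCat.{u} (T2 R)} (hF : InAdd (T2 R) (pMod R C C) F) :
    InAdd R C (ModuleCat.of R (SndComp R F)) := by
  obtain ⟨X, s, r, hX, h⟩ := hF.exists_retract_pMod
  refine (hX.prod hX).of_retract ((TriMod.sndEquiv _).toLinearMap ∘ₗ SndComp.map s)
    (SndComp.map r ∘ₗ (TriMod.sndEquiv _).symm.toLinearMap) fun x => ?_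
  rw [LinearMap.comp_apply, LinearMap.comp_apply, LinearEquiv.coe_coe, LinearEquiv.coe_coe,
    LinearEquiv.symm_apply_apply]
  exact Subtype.ext (h x.1)

theorem InAdd.fstComp {F : ModuleCat.{u} (T2 R)} (hF : InAdd (T2 R) (pMod R C C) F) :
    InAdd R C (ModuleCat.of R (FstComp R F)) := by
  obtain ⟨X, s, r, hX, h⟩ := hF.exists_retract_pMod
  refine hX.of_retract ((TriMod.fstEquiv _).toLinearMap ∘ₗ FstComp.map s)
    (FstComp.map r ∘ₗ (TriMod.fstEquiv _).symm.toLinearMap) fun x => ?_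
  rw [LinearMap.comp_apply, LinearMap.comp_apply, LinearEquiv.coe_coe, LinearEquiv.coe_coe,
    LinearEquiv.symm_apply_apply]
  exact Subtype.ext (h x.1)

theorem InAdd.strCoker {F : ModuleCat.{u} (T2 R)} (hF : InAdd (T2 R) (pMod R C C) F) :
    InAdd R C (ModuleCat.of R (StrCoker R F)) := by
  obtain ⟨X, s, r, hX, h⟩ := hF.exists_retract_pMod
  obtain ⟨e⟩ := pMod.nonempty_strCokerEquiv (R := R) X X
  refine hX.of_retract (e.toLinearMap ∘ₗ StrCoker.map s)
    (StrCoker.map r ∘ₗ e.symm.toLinearMap) fun x => ?_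
  rw [LinearMap.comp_apply, LinearMap.comp_apply, LinearEquiv.coe_coe, LinearEquiv.coe_coe,
    LinearEquiv.symm_apply_apply]
  obtain ⟨y, rfl⟩ := Submodule.mkQ_surjective _ x
  rw [StrCoker.map_mkQ, StrCoker.map_mkQ]
  exact congrArg _ (Subtype.ext (h y.1))

theorem inAdd_self_iff_projective {M : ModuleCat.{u} R} :
    InAdd R R M ↔ Module.Projective R M := by
  constructor
  · intro h
    obtain ⟨I, s, r, h⟩ := inAdd_iff.1 h
    exact .of_split s r (LinearMap.ext h)
  · intro h
    obtain ⟨s, hs⟩ := h.out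
    exact inAdd_iff.2 ⟨M, s, _, hs⟩

theorem InAdd.of_equiv {D : Type u} [AddCommGroup D] [Module R D] (e : C ≃ₗ[R] D)
    {M : ModuleCat.{u} R} (hM : InAdd R C M) : InAdd R D M := by
  obtain ⟨I, s, r, h⟩ := inAdd_iff.1 hM
  exact inAdd_iff.2 ⟨I, Finsupp.mapRange.linearMap e.toLinearMap ∘ₗ s,
    r ∘ₗ Finsupp.mapRange.linearMap e.symm.toLinearMap, fun x => by
      rw [LinearMap.comp_apply, LinearMap.comp_apply, ← LinearMap.comp_apply (f := Finsupp.mapRange.linearMap _),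
        ← Finsupp.mapRange.linearMap_comp]
      simp [h]⟩

variable (R) in
/-- The ring `T(R)` is `p(R, R)` as a module over itself. -/
def T2.equivPMod : T2 R ≃ₗ[T2 R] pMod R R R where
  toFun t := ((t.1 0 0, t.1 1 0, t.1 1 1) : R × R × R)
  map_add' _ _ := rfl
  map_smul' s t := by
    have hs : s.1 0 1 = 0 := s.2
    have ht : t.1 0 1 = 0 := t.2
    refine Prod.ext ?_ (Prod.ext ?_ ?_)
    · change (s.1 * t.1) 0 0 = s.1 0 0 * t.1 0 0
      simp [Matrix.mul_apply, hs]
    · change (s.1 * t.1) 1 0 = s.1 1 0 * t.1 0 0 + s.1 1 1 * t.1 1 0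
      simp [Matrix.mul_apply]
    · change (s.1 * t.1) 1 1 = 0 + s.1 1 1 * t.1 1 1
      simp [Matrix.mul_apply, ht]
  invFun z := T2.mk z.1 z.2.1 z.2.2
  left_inv t := (T2.eq_mk t).symm
  right_inv z := rfl

theorem inAdd_pMod_self_iff_projective {M : ModuleCat.{u} (T2 R)} :
    InAdd (T2 R) (pMod R R R) M ↔ Module.Projective (T2 R) M := by
  rw [← inAdd_self_iff_projective]
  exact ⟨.of_equiv (T2.equivPMod R).symm, .of_equiv (T2.equivPMod R)⟩

end TriangularAdd

/-! ### The criterion for `G_C`-projectivity over `T(R)`. -/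

section TriangularGorenstein

theorem IsSES.nonempty_cokerEquiv {R : Type u} [Ring R] {X Y Z Y' Z' : Type u}
    [AddCommGroup X] [Module R X] [AddCommGroup Y] [Module R Y] [AddCommGroup Z] [Module R Z]
    [AddCommGroup Y'] [Module R Y'] [AddCommGroup Z'] [Module R Z']
    {i : X →ₗ[R] Y} {q : Y →ₗ[R] Z} {i' : X →ₗ[R] Y'} {q' : Y' →ₗ[R] Z'}
    (h : IsSES i q) (h' : IsSES i' q') (e : Y ≃ₗ[R] Y') (he : ∀ x, e (i x) = i' x) :
    Nonempty (Z ≃ₗ[R] Z') := by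
  obtain ⟨k, hk⟩ := h.exists_desc (q' ∘ₗ e.toLinearMap) fun x => by
    rw [LinearMap.comp_apply, LinearEquiv.coe_coe, he, h'.comp_apply]
  obtain ⟨l, hl⟩ := h'.exists_desc (q ∘ₗ e.symm.toLinearMap) fun x => by
    rw [LinearMap.comp_apply, LinearEquiv.coe_coe, ← he, LinearEquiv.symm_apply_apply,
      h.comp_apply]
  refine ⟨.ofLinearMap k l (LinearMap.ext fun z => ?_) (LinearMap.ext fun z => ?_)⟩
  · obtain ⟨y, rfl⟩ := h'.surj z
    rw [LinearMap.comp_apply, hl, LinearMap.comp_apply, hk]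
    simp
  · obtain ⟨y, rfl⟩ := h.surj z
    rw [LinearMap.comp_apply, hk, LinearMap.comp_apply, LinearEquiv.coe_coe, hl]
    simp

variable {R : Type u} [Ring R] {C : Type u} [AddCommGroup C] [Module R C]

section

variable {P : ModuleCat.{u} (T2 R)}

theorem strMap_injective_of_projective (hP : Module.Projective (T2 R) P) :
    Function.Injective (strMap R P) :=
  (inAdd_pMod_self_iff_projective.2 hP).strMap_injective

theorem projective_fstComp (hP : Module.Projective (T2 R) P) :
    Module.Projective R (FstComp R P) :=
  inAdd_self_iff_projective.1 (inAdd_pMod_self_iff_projective.2 hP).fstComp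

theorem projective_sndComp (hP : Module.Projective (T2 R) P) :
    Module.Projective R (SndComp R P) :=
  inAdd_self_iff_projective.1 (inAdd_pMod_self_iff_projective.2 hP).sndComp

theorem projective_strCoker (hP : Module.Projective (T2 R) P) :
    Module.Projective R (StrCoker R P) :=
  inAdd_self_iff_projective.1 (inAdd_pMod_self_iff_projective.2 hP).strCoker

end

section

variable {K P : Type u} [AddCommGroup K] [Module (T2 R) K] [AddCommGroup P] [Module (T2 R) P]
  {i : K →ₗ[T2 R] P}

/-- A target in `Add(p(C, C))` is a retract of some `p(X, X)`, and a map into that is a pair whose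
two entries can be extended independently. -/
theorem ExtendsAlong.of_components (h2 : ExtendsAlong (InAdd R C) (SndComp.map i))
    (hc : ExtendsAlong (InAdd R C) (StrCoker.map i)) :
    ExtendsAlong (InAdd (T2 R) (pMod R C C)) i := by
  intro F hF f
  obtain ⟨X, s, r, hX, hrs⟩ := hF.exists_retract_pMod
  obtain ⟨g, k, hgk⟩ := pMod.exists_eq_lift (s ∘ₗ f)
  obtain ⟨g', hg⟩ := h2 X hX g
  obtain ⟨k', hk⟩ := hc X hX k
  refine ⟨r ∘ₗ pMod.lift g' k', fun x => ?_⟩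
  rw [← hrs (f x), ← LinearMap.comp_apply s f, hgk, LinearMap.comp_apply]
  congr 1
  rw [pMod.lift_apply, pMod.lift_apply, toFst_map, toSnd_map, strMap_map, hg, hg,
    ← StrCoker.map_mkQ, hk]

/-- The map to `F` is tested through `p(F, F)`, with zero on the cokernel part. -/
theorem ExtendsAlong.sndComp (h : ExtendsAlong (InAdd (T2 R) (pMod R C C)) i) :
    ExtendsAlong (InAdd R C) (SndComp.map i) := by
  intro F hF f
  obtain ⟨k, hk⟩ := h _ (inAdd_pMod hF hF) (pMod.lift f 0)
  obtain ⟨g', k', rfl⟩ := pMod.exists_eq_lift k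
  refine ⟨g', fun x => ?_⟩
  have := congrArg (fun z : F × F × F => z.2.1) (hk x.1)
  change g' (toSnd R (i x.1)) = f (toSnd R x.1) at this
  rwa [toSnd_map, toSnd_coe] at this

theorem ExtendsAlong.strCoker (h : ExtendsAlong (InAdd (T2 R) (pMod R C C)) i) :
    ExtendsAlong (InAdd R C) (StrCoker.map i) := by
  intro F hF f
  obtain ⟨k, hk⟩ := h _ (inAdd_pMod hF hF) (pMod.lift 0 f)
  obtain ⟨g', k', rfl⟩ := pMod.exists_eq_lift k
  refine ⟨k', fun x => ?_⟩
  obtain ⟨y, rfl⟩ := Submodule.mkQ_surjective _ x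
  have := congrArg (fun z : F × F × F => z.2.2) (hk y.1)
  change k' ((LinearMap.range _).mkQ (toSnd R (i y.1))) =
    f ((LinearMap.range _).mkQ (toSnd R y.1)) at this
  rwa [toSnd_map, toSnd_coe] at this

end

theorem HasRightResolution.strMap_injective {M : ModuleCat.{u} (T2 R)}
    (hM : HasRightResolution (InAdd (T2 R) (pMod R C C)) M) :
    Function.Injective (strMap R M) := by
  obtain ⟨A, N, j, q, hA, -, hs, -⟩ := hM.step
  exact strMap_injective_of_injective hs.inj hA.strMap_injective

/-- Taking cokernels of structure maps is not left exact in general. It is exact here because all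
syzygies and cosyzygies involved embed in modules with injective structure map. -/
theorem IsGCProjective.strCoker {M : ModuleCat.{u} (T2 R)}
    (hM : IsGCProjective (T2 R) (pMod R C C) M) :
    IsGCProjective R C (ModuleCat.of R (StrCoker R M)) := by
  obtain ⟨hl, hr⟩ := hasCompleteResolution_iff.1 hM
  refine hasCompleteResolution_iff.2
    ⟨⟨fun Y => ∃ X : ModuleCat.{u} (T2 R), Y = ModuleCat.of R (StrCoker R X) ∧
      HasLeftResolution (InAdd (T2 R) (pMod R C C)) X ∧ Function.Injective (strMap R X),
      ⟨M, rfl, hl, hr.strMap_injective⟩, ?_⟩,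
    ⟨fun Y => ∃ X : ModuleCat.{u} (T2 R), Y = ModuleCat.of R (StrCoker R X) ∧
      HasRightResolution (InAdd (T2 R) (pMod R C C)) X, ⟨M, rfl, hr⟩, ?_⟩⟩
  · rintro _ ⟨X, rfl, hX, hinj⟩
    obtain ⟨K, P, i, q, hP, hK, hs, he⟩ := hX.step
    exact ⟨_, ModuleCat.of R (StrCoker R P), StrCoker.map i, StrCoker.map q,
      projective_strCoker hP, ⟨K, rfl, hK, strMap_injective_of_injective hs.inj
        (strMap_injective_of_projective hP)⟩, hs.strCoker hinj, he.strCoker⟩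
  · rintro _ ⟨X, rfl, hX⟩
    obtain ⟨A, N, j, q, hA, hN, hs, he⟩ := hX.step
    exact ⟨ModuleCat.of R (StrCoker R A), _, StrCoker.map j, StrCoker.map q, hA.strCoker,
      ⟨N, rfl, hN⟩, hs.strCoker hN.strMap_injective, he.strCoker⟩

theorem IsGCProjective.sndComp {M : ModuleCat.{u} (T2 R)}
    (hM : IsGCProjective (T2 R) (pMod R C C) M) :
    IsGCProjective R C (ModuleCat.of R (SndComp R M)) := by
  obtain ⟨hl, hr⟩ := hasCompleteResolution_iff.1 hM
  refine hasCompleteResolution_iff.2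
    ⟨⟨fun Y => ∃ X : ModuleCat.{u} (T2 R), Y = ModuleCat.of R (SndComp R X) ∧
      HasLeftResolution (InAdd (T2 R) (pMod R C C)) X, ⟨M, rfl, hl⟩, ?_⟩,
    ⟨fun Y => ∃ X : ModuleCat.{u} (T2 R), Y = ModuleCat.of R (SndComp R X) ∧
      HasRightResolution (InAdd (T2 R) (pMod R C C)) X, ⟨M, rfl, hr⟩, ?_⟩⟩
  · rintro _ ⟨X, rfl, hX⟩
    obtain ⟨K, P, i, q, hP, hK, hs, he⟩ := hX.step
    exact ⟨_, ModuleCat.of R (SndComp R P), SndComp.map i, SndComp.map q,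
      projective_sndComp hP, ⟨K, rfl, hK⟩, hs.sndComp, he.sndComp⟩
  · rintro _ ⟨X, rfl, hX⟩
    obtain ⟨A, N, j, q, hA, hN, hs, he⟩ := hX.step
    exact ⟨ModuleCat.of R (SndComp R A), _, SndComp.map j, SndComp.map q, hA.sndComp,
      ⟨N, rfl, hN⟩, hs.sndComp, he.sndComp⟩

variable (C) in
/-- The structure map is injective, and its source and cokernel are `G_C`-projective. -/
structure HasGCProjectiveComponents (M : ModuleCat.{u} (T2 R)) : Prop where
  inj : Function.Injective (strMap R M)
  fst : IsGCProjective R C (ModuleCat.of R (FstComp R M))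
  coker : IsGCProjective R C (ModuleCat.of R (StrCoker R M))

namespace HasGCProjectiveComponents

variable {X Y Z M : ModuleCat.{u} (T2 R)} {i : X →ₗ[T2 R] Y} {q : Y →ₗ[T2 R] Z}

theorem snd (hC : IsWTilting R C) (hM : HasGCProjectiveComponents C M) :
    IsGCProjective R C (ModuleCat.of R (SndComp R M)) :=
  .ext hC (X := ModuleCat.of R (FstComp R M)) (Z := ModuleCat.of R (StrCoker R M))
    (isSES_strMap hM.inj) hM.fst hM.coker

theorem of_projective (hC : IsWTilting R C) {P : ModuleCat.{u} (T2 R)}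
    (hP : Module.Projective (T2 R) P) : HasGCProjectiveComponents C P :=
  ⟨strMap_injective_of_projective hP, .of_projective hC (projective_fstComp hP),
    .of_projective hC (projective_strCoker hP)⟩

theorem ext (hC : IsWTilting R C) (hs : IsSES i q) (hX : HasGCProjectiveComponents C X)
    (hZ : HasGCProjectiveComponents C Z) : HasGCProjectiveComponents C Y :=
  ⟨hs.strMap_injective hX.inj hZ.inj,
    .ext hC (X := ModuleCat.of R (FstComp R X)) (Z := ModuleCat.of R (FstComp R Z))
      hs.fstComp hX.fst hZ.fst,
    .ext hC (X := ModuleCat.of R (StrCoker R X)) (Z := ModuleCat.of R (StrCoker R Z))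
      (hs.strCoker hZ.inj) hX.coker hZ.coker⟩

theorem ker (hC : IsWTilting R C) (hs : IsSES i q) (hY : HasGCProjectiveComponents C Y)
    (hZ : HasGCProjectiveComponents C Z) : HasGCProjectiveComponents C X :=
  ⟨strMap_injective_of_injective hs.inj hY.inj,
    .ker hC (Y := ModuleCat.of R (FstComp R Y)) (Z := ModuleCat.of R (FstComp R Z))
      hs.fstComp hY.fst hZ.fst,
    .ker hC (Y := ModuleCat.of R (StrCoker R Y)) (Z := ModuleCat.of R (StrCoker R Z))
      (hs.strCoker hZ.inj) hY.coker hZ.coker⟩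

theorem extendsAlong (hC : IsWTilting R C) (hs : IsSES i q)
    (hZ : HasGCProjectiveComponents C Z) : ExtendsAlong (InAdd (T2 R) (pMod R C C)) i :=
  .of_components
    (ExtVanishing.extendsAlong (X := ModuleCat.of R (SndComp R X))
      (Y := ModuleCat.of R (SndComp R Y)) hs.sndComp (hZ.snd hC).extVanishing)
    (ExtVanishing.extendsAlong (X := ModuleCat.of R (StrCoker R X))
      (Y := ModuleCat.of R (StrCoker R Y)) (hs.strCoker hZ.inj) hZ.coker.extVanishing)

/-- Embeddings `M₁ → A` and `coker φ → B` with `G_C`-projective cokernels are glued to one embedding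
`M → p(A, B)` whose cokernel has the same kind of components. -/
theorem rightStep (hC : IsWTilting R C) (hM : HasGCProjectiveComponents C M) :
    RightStep (InAdd (T2 R) (pMod R C C)) (HasGCProjectiveComponents C) M := by
  obtain ⟨A, X', a, a', hA, hX', ha⟩ := hM.fst.exists_cosyzygy hC
  obtain ⟨B, Y', b, b', hB, hY', hb⟩ := hM.coker.exists_cosyzygy hC
  -- A map to `p(A, B)` needs its `A`-part on all of `M₂`; `a` extends there because `Ext¹(coker φ,
  -- A) = 0`. The resulting `j` then induces `a` on first components and `b` on cokernels.
  obtain ⟨t, ht⟩ := ExtVanishing.extendsAlong (X := ModuleCat.of R (FstComp R M))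
    (Y := ModuleCat.of R (SndComp R M)) (isSES_strMap hM.inj) hM.coker.extVanishing A hA a
  let j : M →ₗ[T2 R] pMod R A B := pMod.lift t b
  let e₁ := TriMod.fstEquiv (LinearMap.inl R A B)
  have hfst : ∀ x, e₁ (FstComp.map j x) = a x := fun x => by
    change t (strMap R M (toFst R x.1)) = a x
    rw [toFst_coe, ht]
  let p : SndComp R (pMod R A B) →ₗ[R] B :=
    LinearMap.snd R A B ∘ₗ (TriMod.sndEquiv (LinearMap.inl R A B)).toLinearMap
  obtain ⟨e₂, he₂⟩ : ∃ e : StrCoker R (pMod R A B) ≃ₗ[R] B,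
      ∀ y, e ((LinearMap.range (strMap R (pMod R A B))).mkQ y) = p y := by
    have hp : ∀ x, p (strMap R _ x) = 0 := fun x =>
      congrArg Prod.snd (TriMod.sndEquiv_strMap (φ := LinearMap.inl R A B) x)
    refine ⟨LinearEquiv.ofBijective (Submodule.liftQ _ p ?_) ⟨?_, fun y => ?_⟩, fun y => rfl⟩
    · rintro _ ⟨x, rfl⟩
      exact hp x
    · rw [injective_iff_map_eq_zero]
      intro y hy
      obtain ⟨z, rfl⟩ := Submodule.mkQ_surjective _ y
      have hz : (TriMod.sndEquiv (LinearMap.inl R A B) z).2 = 0 := hy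
      refine strCoker_mkQ_eq_zero.2 ⟨e₁.symm (TriMod.sndEquiv (LinearMap.inl R A B) z).1,
        (TriMod.sndEquiv (LinearMap.inl R A B)).injective ?_⟩
      rw [TriMod.sndEquiv_strMap, LinearEquiv.apply_symm_apply]
      exact Prod.ext rfl hz.symm
    · exact ⟨(LinearMap.range (strMap R (pMod R A B))).mkQ
        ((TriMod.sndEquiv (LinearMap.inl R A B)).symm (0, y)), rfl⟩
  have hcoker : ∀ x, e₂ (StrCoker.map j x) = b x := fun x => by
    obtain ⟨y, rfl⟩ := Submodule.mkQ_surjective _ x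
    rw [StrCoker.map_mkQ, he₂]
    change b ((LinearMap.range (strMap R M)).mkQ (toSnd R y.1)) = _
    rw [toSnd_coe]
  have hcinj : Function.Injective (StrCoker.map j) := fun x y hxy => hb.inj (by
    rw [← hcoker, ← hcoker, hxy])
  have hinj : Function.Injective j := by
    rw [injective_iff_map_eq_zero]
    intro m hm
    have h1 : toFst R m = 0 := ha.inj (by
      rw [← hfst, ← toFst_map, hm, map_zero, ← map_zero e₁]
      exact congrArg e₁ (Subtype.ext (smul_zero _)))
    have h2 : ∃ x, strMap R M x = toSnd R m := strCoker_mkQ_eq_zero.1 (hcinj (by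
      rw [StrCoker.map_mkQ, ← toSnd_map, hm, map_zero, ← map_zero (Submodule.mkQ _)]
      exact congrArg _ (Subtype.ext (smul_zero _))))
    obtain ⟨x, hx⟩ := h2
    have hx0 : x = 0 := ha.inj (by
      rw [map_zero, ← ht, hx]
      exact congrArg (fun z : A × A × B => z.2.1) hm)
    have h3 : toSnd R m = 0 := by rw [← hx, hx0, map_zero]
    rw [← toFst_add_toSnd (R := R) m, h1, h3]
    exact add_zero 0
  have hs := IsSES.mkQ hinj
  -- Injectivity of `j` on cokernels is what keeps the structure map of the quotient injective, so
  -- that its first component and cokernel are `X'` and `Y'`.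
  have hQinj := hs.strMap_injective_right hcinj (TriMod.strMap_injective LinearMap.inl_injective)
  have hQ : HasGCProjectiveComponents C (ModuleCat.of (T2 R) (pMod R A B ⧸ LinearMap.range j)) := by
    refine ⟨hQinj, ?_, ?_⟩
    · obtain ⟨e⟩ := ha.nonempty_cokerEquiv hs.fstComp e₁.symm
        fun x => by rw [← hfst, LinearEquiv.symm_apply_apply]
      exact hC.isResolving.of_equiv e hX'
    · obtain ⟨e⟩ := hb.nonempty_cokerEquiv (hs.strCoker hQinj) e₂.symm
        fun x => by rw [← hcoker, LinearEquiv.symm_apply_apply]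
      exact hC.isResolving.of_equiv e hY'
  exact ⟨ModuleCat.of (T2 R) (pMod R A B), _, j, _, inAdd_pMod hA hB, hQ, hs,
    hQ.extendsAlong hC hs⟩

theorem leftStep (hC : IsWTilting R C) (hM : HasGCProjectiveComponents C M) :
    LeftStep (InAdd (T2 R) (pMod R C C)) (HasGCProjectiveComponents C) M := by
  obtain ⟨K, P, i, q, hP, hs⟩ := exists_projective_presentation M
  exact ⟨K, P, i, q, hP, .ker hC hs (.of_projective hC hP) hM, hs, hM.extendsAlong hC hs⟩

end HasGCProjectiveComponents

theorem isGCProjective_pMod_iff (hC : IsWTilting R C) {M : ModuleCat.{u} (T2 R)} :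
    IsGCProjective (T2 R) (pMod R C C) M ↔ HasGCProjectiveComponents C M := by
  constructor
  · intro hM
    have hinj := (hasCompleteResolution_iff.1 hM).2.strMap_injective
    -- `M₁` is the kernel of `M₂ → coker φ`, and both of these inherit a complete resolution from
    -- `M`.
    exact ⟨hinj, .ker hC (Y := ModuleCat.of R (SndComp R M)) (Z := ModuleCat.of R (StrCoker R M))
      (isSES_strMap hinj) hM.sndComp hM.strCoker, hM.strCoker⟩
  · exact fun hM => hasCompleteResolution_iff.2 ⟨⟨_, hM, fun _ h => h.leftStep hC⟩,
      ⟨_, hM, fun _ h => h.rightStep hC⟩⟩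

/-! ### Comparison of dimensions over `T(R)` and `R`. -/

theorem isResolving_pMod (hC : IsWTilting R C) :
    IsResolving (IsGCProjective (T2 R) (pMod R C C)) where
  proj P hP := (isGCProjective_pMod_iff hC).2 (.of_projective hC hP)
  ext hs hX hZ := by
    rw [isGCProjective_pMod_iff hC] at *
    exact .ext hC hs hX hZ
  ker hs hY hZ := by
    rw [isGCProjective_pMod_iff hC] at *
    exact .ker hC hs hY hZ

/-- Length zero is the criterion. A projective presentation of `M` induces projective presentations
of `M₁` and of `coker φ`, and its syzygy again has injective structure map, so all three lengths
drop together. -/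
theorem hasResolutionOfLength_pMod_iff (hC : IsWTilting R C) {n : ℕ} {M : ModuleCat.{u} (T2 R)}
    (hM : Function.Injective (strMap R M)) :
    HasResolutionOfLength (IsGCProjective (T2 R) (pMod R C C)) M n ↔
      HasResolutionOfLength (IsGCProjective R C) (ModuleCat.of R (FstComp R M)) n ∧
      HasResolutionOfLength (IsGCProjective R C) (ModuleCat.of R (StrCoker R M)) n := by
  induction n generalizing M with
  | zero =>
    rw [(isResolving_pMod hC).hasResolutionOfLength_zero,
      hC.isResolving.hasResolutionOfLength_zero, hC.isResolving.hasResolutionOfLength_zero,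
      isGCProjective_pMod_iff hC]
    exact ⟨fun h => ⟨h.fst, h.coker⟩, fun h => ⟨hM, h.1, h.2⟩⟩
  | succ n ih =>
    obtain ⟨K, P, i, q, hP, hs⟩ := exists_projective_presentation M
    rw [(isResolving_pMod hC).hasResolutionOfLength_succ_iff hP hs,
      ih (strMap_injective_of_injective hs.inj (strMap_injective_of_projective hP)),
      hC.isResolving.hasResolutionOfLength_succ_iff (K := ModuleCat.of R (FstComp R K))
        (P := ModuleCat.of R (FstComp R P))
        (X := ModuleCat.of R (FstComp R M)) (projective_fstComp hP) hs.fstComp,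
      hC.isResolving.hasResolutionOfLength_succ_iff (K := ModuleCat.of R (StrCoker R K))
        (P := ModuleCat.of R (StrCoker R P))
        (X := ModuleCat.of R (StrCoker R M)) (projective_strCoker hP) (hs.strCoker hM)]

theorem hasResolutionOfLength_of_pMod (hC : IsWTilting R C) {n : ℕ} (N : ModuleCat.{u} R)
    (h : HasResolutionOfLength (IsGCProjective (T2 R) (pMod R C C))
      (ModuleCat.of (T2 R) (TriMod (0 : N →ₗ[R] PUnit.{u + 1}))) (n + 1)) :
    HasResolutionOfLength (IsGCProjective R C) N n := by
  obtain ⟨K, P, i, q, hP, hs⟩ := exists_projective_presentation N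
  -- `(K → P)` is the syzygy of `(N, 0)` in the projective module `p(P, 0)`; the trivial factor only
  -- brings `P` into the form `P ⊕ 0`.
  let φ : K →ₗ[R] P × PUnit.{u + 1} := LinearMap.inl R P PUnit.{u + 1} ∘ₗ i
  have hφ : Function.Injective φ := LinearMap.inl_injective.comp hs.inj
  let j : TriMod φ →ₗ[T2 R] pMod R P PUnit.{u + 1} := TriMod.map i LinearMap.id fun _ => rfl
  let r : pMod R P PUnit.{u + 1} →ₗ[T2 R] TriMod (0 : N →ₗ[R] PUnit.{u + 1}) :=
    TriMod.map q 0 fun _ => rfl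
  have hjr : IsSES j r := by
    refine ⟨hs.inj.prodMap Function.injective_id, fun z => ⟨fun hz => ?_, ?_⟩, fun z => ?_⟩
    · obtain ⟨k, hk⟩ := (hs.exact z.1).1 (congrArg Prod.fst hz)
      exact ⟨((k, z.2) : K × P × PUnit), Prod.ext hk rfl⟩
    · rintro ⟨w, rfl⟩
      exact Prod.ext (hs.comp_apply w.1) rfl
    · obtain ⟨p, hp⟩ := hs.surj z.1
      exact ⟨((p, p, 0) : P × P × PUnit), Prod.ext hp rfl⟩
  have hproj : Module.Projective (T2 R) (ModuleCat.of (T2 R) (pMod R P PUnit.{u + 1})) :=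
    inAdd_pMod_self_iff_projective.1 (inAdd_pMod (Y := ModuleCat.of R PUnit)
      (inAdd_self_iff_projective.2 hP) (inAdd_self_iff_projective.2 inferInstance))
  rw [(isResolving_pMod hC).hasResolutionOfLength_succ_iff (K := ModuleCat.of (T2 R) (TriMod φ))
    hproj hjr, hasResolutionOfLength_pMod_iff hC (TriMod.strMap_injective hφ)] at h
  have hex : Function.Exact φ (q ∘ₗ LinearMap.fst R P PUnit.{u + 1}) := fun y =>
    (hs.exact y.1).trans ⟨fun ⟨x, hx⟩ => ⟨x, Prod.ext hx rfl⟩,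
      fun ⟨x, hx⟩ => ⟨x, congrArg Prod.fst hx⟩⟩
  obtain ⟨e⟩ := TriMod.nonempty_strCokerEquiv (ψ := q ∘ₗ LinearMap.fst R P PUnit.{u + 1})
    (hs.surj.comp LinearMap.fst_surjective) hex
  exact h.2.of_equiv e

theorem IsResolving.iSup_resolutionDim_le {S : Type u} [Ring S] {𝓖 : ModuleCat.{u} S → Prop}
    (h𝓖 : IsResolving 𝓖) {n : ℕ} :
    ⨆ M, resolutionDim 𝓖 M ≤ n ↔ ∀ M, HasResolutionOfLength 𝓖 M n := by
  rw [iSup_le_iff]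
  exact forall_congr' fun M => h𝓖.resolutionDim_le

theorem gcProjectiveGlobalDim_pMod_le_succ_iff (hC : IsWTilting R C) {n : ℕ} :
    gcProjectiveGlobalDim (T2 R) (pMod R C C) ≤ (n + 1 : ℕ) ↔ gcProjectiveGlobalDim R C ≤ n := by
  refine (isResolving_pMod hC).iSup_resolutionDim_le.trans
    (Iff.trans ?_ hC.isResolving.iSup_resolutionDim_le.symm)
  refine ⟨fun h N => hasResolutionOfLength_of_pMod hC N (h _), fun h M => ?_⟩
  obtain ⟨K, P, i, q, hP, hs⟩ := exists_projective_presentation M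
  rw [(isResolving_pMod hC).hasResolutionOfLength_succ_iff hP hs, hasResolutionOfLength_pMod_iff hC
    (strMap_injective_of_injective hs.inj (strMap_injective_of_projective hP))]
  exact ⟨h _, h _⟩

theorem not_gcProjectiveGlobalDim_pMod_le_zero [Nontrivial R] (hC : IsWTilting R C) :
    ¬ gcProjectiveGlobalDim (T2 R) (pMod R C C) ≤ (0 : ℕ) := by
  intro h
  have := (isResolving_pMod hC).iSup_resolutionDim_le.1 h
    (ModuleCat.of (T2 R) (TriMod (0 : R →ₗ[R] PUnit.{u + 1})))
  rw [(isResolving_pMod hC).hasResolutionOfLength_zero, isGCProjective_pMod_iff hC] at this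
  -- The structure map `R → 0` would be injective, which identifies `0` and `1` in `R`.
  exact zero_ne_one (TriMod.injective_of_strMap this.inj (a₁ := (0 : R)) (a₂ := 1) rfl)

/-- In `ℕ∞` the value is determined by its finite upper bounds: `n + 1` bounds one side iff `n`
bounds the other, and `0` never bounds the dimension over `T(R)`. This covers the infinite case as
well. -/
theorem gcProjectiveGlobalDim_pMod [Nontrivial R] (hC : IsWTilting R C) :
    gcProjectiveGlobalDim (T2 R) (pMod R C C) = gcProjectiveGlobalDim R C + 1 := by
  have h1 : ∀ n : ℕ, _ := fun n => gcProjectiveGlobalDim_pMod_le_succ_iff hC (n := n)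
  have h2 := not_gcProjectiveGlobalDim_pMod_le_zero hC
  generalize gcProjectiveGlobalDim (T2 R) (pMod R C C) = x at h1 h2
  generalize gcProjectiveGlobalDim R C = y at h1
  refine le_antisymm ?_ ?_
  · induction y with
    | top => exact le_top
    | coe m => exact (h1 m).2 le_rfl
  · induction x with
    | top => exact le_top
    | coe k =>
      obtain _ | k := k
      · exact absurd le_rfl h2
      · rw [Nat.cast_add]
        exact add_le_add_left ((h1 k).1 le_rfl) _

theorem isWTilting_self : IsWTilting R R := by
  refine ⟨fun I n hn => subsingleton_ext_of_projective (P := ModuleCat.of R R)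
    (inferInstanceAs (Module.Projective R R)) _ hn, ?_⟩
  -- The coresolution is `0 → R → R → 0 → ⋯` with the identity as its only nonzero map.
  let A : ℕ → ModuleCat.{u} R := fun | 0 => ModuleCat.of R R | _ + 1 => ModuleCat.of R PUnit
  have hA : ∀ n, InAdd R R (A n)
    | 0 => inAdd_self_iff_projective.2 (inferInstanceAs (Module.Projective R R))
    | _ + 1 => inAdd_self_iff_projective.2 (inferInstanceAs (Module.Projective R PUnit.{u + 1}))
  have h0 : ∀ {X Y Z : Type u} [AddCommGroup X] [Module R X] [AddCommGroup Y] [Module R Y]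
      [AddCommGroup Z] [Module R Z] [Subsingleton Y] (f : X →ₗ[R] Y) (g : Y →ₗ[R] Z),
      IsHomExactAt (InAdd R R) f g := fun f g =>
    ⟨fun y => ⟨fun _ => ⟨0, Subsingleton.elim _ _⟩, fun _ => by
      rw [Subsingleton.elim y 0, map_zero]⟩, fun F _ h => ⟨fun _ => ⟨0, LinearMap.ext fun y => by
        rw [Subsingleton.elim y 0, map_zero, map_zero]⟩, fun _ => LinearMap.ext fun x => by
        rw [LinearMap.comp_apply, Subsingleton.elim (f x) 0, map_zero, LinearMap.zero_apply]⟩⟩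
  refine ⟨A, (LinearMap.id : R →ₗ[R] R), fun _ => 0, hA, ⟨fun y => ?_, fun F _ h => ?_⟩,
    ⟨fun y => ?_, fun F _ h => ?_⟩, fun n => ?_⟩
  · exact ⟨fun h => ⟨0, h.symm⟩, fun ⟨x, hx⟩ => hx.symm⟩
  · exact ⟨fun _ => ⟨h, rfl⟩, fun _ => LinearMap.ext fun x => map_zero h⟩
  · exact ⟨fun _ => ⟨y, rfl⟩, fun _ => rfl⟩
  · refine ⟨fun hh => ⟨0, ?_⟩, ?_⟩
    · exact LinearMap.ext fun x => (LinearMap.congr_fun hh x).symm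
    · rintro ⟨k, rfl⟩
      exact LinearMap.ext fun x => map_zero k
  · have : Subsingleton (A (n + 1)) := inferInstanceAs (Subsingleton PUnit.{u + 1})
    exact h0 _ _

theorem leftGorensteinGlobalDim_eq_of_forall {S : Type u} [Ring S] {D : Type u} [AddCommGroup D]
    [Module S D] (h : ∀ M : ModuleCat.{u} S, InAdd S D M ↔ Module.Projective S M) :
    leftGorensteinGlobalDim S = gcProjectiveGlobalDim S D := by
  have : InAdd S D = fun N : ModuleCat.{u} S => Module.Projective S N :=
    funext fun M => propext (h M)
  unfold leftGorensteinGlobalDim gcProjectiveGlobalDim gorensteinProjectiveDim gcProjectiveDim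
  congr! with M
  unfold IsGorensteinProjective IsGCProjective
  rw [this]

end TriangularGorenstein

theorem mainTheorem10 (R : Type u) [Ring R] [Nontrivial R] :
    (∀ (C₁ : Type u) [AddCommGroup C₁] [Module R C₁], IsWTilting R C₁ →
      gcProjectiveGlobalDim (T2 R) (pMod R C₁ C₁) = gcProjectiveGlobalDim R C₁ + 1) ∧
    (∀ n : ℕ, IsLeftGorensteinRegular (T2 R) (n + 1) ↔ IsLeftGorensteinRegular R n) := by
  refine ⟨fun C₁ _ _ hC => gcProjectiveGlobalDim_pMod hC, fun n => ?_⟩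
  unfold IsLeftGorensteinRegular
  rw [leftGorensteinGlobalDim_eq_of_forall (S := T2 R) (D := pMod R R R)
      fun _ => inAdd_pMod_self_iff_projective,
    leftGorensteinGlobalDim_eq_of_forall (S := R) (D := R) fun _ => inAdd_self_iff_projective,
    gcProjectiveGlobalDim_pMod isWTilting_self, Nat.cast_add, Nat.cast_one]
  exact WithTop.add_right_inj ENat.one_ne_top
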